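/- Let $m\ge 1$ and let $\mathcal M$ be the alphabet $1<2<\cdots<m<\overline m<\cdots<\overline 2<\overline 1$. Let $\mu\subseteq\lambda$ be partitions and $n=|\lambda|-|\mu|$ the number of boxes of the skew shape $\lambda/\mu$. A *column* is a finite strictly increasing (top to bottom) sequence $C$ of letters of $\mathcal M$. It is *admissible* if, whenever $i$ and $\overline i$ both occur in $C$, with $i$ in the $p$-th box from the top and $\overline i$ in the $q$-th box from the bottom, one has $p+q\le i$. For an admissible column $C$, let $z_1>\cdots>z_r$ be the unbarred letters $z$ such that both $z$ and $\overline z$ occur in $C$, and define successively $t_k$ to be the greatest letter $t\in\{1,\dots,m\}$ such that $t<z_k$, $t<t_l$ for all $l<k$, and neither $t$ nor $\overline t$ occurs in $C$ (such letters exist). Let $\ell C$ be the column obtained from $C$ by replacing each $z_k$ by $t_k$ and rearranging in increasing order, and $rC$ the column obtained from $C$ by replacing each $\overline{z_k}$ by $\overline{t_k}$ and rearranging in increasing order. A *Kashiwara–Nakashima skew symplectic tableau* of shape $\lambda/\mu$ is a filling $T$ of the boxes of $\lambda/\mu$ with letters of $\mathcal M$, weakly increasing along rows and strictly increasing down columns,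 all of whose columns are admissible and whose split form, obtained by replacing each column $C$ by the two adjacent columns $\ell C$, $rC$ (occupying the same rows as $C$), again has weakly increasing rows and strictly increasing columns. Let $SP(\lambda/\mu,2m)$ be the finite set of these tableaux. For $T\in SP(\lambda/\mu,2m)$ let $a_x$ be the number of entries of $T$ equal to $x\in\mathcal M$, and put $$\mathrm{wt}(T)=(\chi_1,\dots,\chi_m),\quad \chi_i=a_i-a_{\overline i},\qquad \mathrm{pwr}(T)=\sum_{i=1}^m\bigl((i-1)a_i+(2m-i)a_{\overline i}\bigr),\qquad X(q)=\sum_{T\in SP(\lambda/\mu,2m)}q^{\mathrm{pwr}(T)}.$$ **Theorem.** Suppose that $n$ is odd and that $\gcd(m,p)=1$ for every odd prime $p\le n$. Let $\langle g\rangle$ be any cyclic group of order $2m$ acting on $SP(\lambda/\mu,2m)$ such that $\mathrm{wt}(gT)=(-\chi_m,\chi_1,\dots,\chi_{m-1})$ for every $T\in SP(\lambda/\mu,2m)$ with $\mathrm{wt}(T)=(\chi_1,\dots,\chi_m)$. Then $(SP(\lambda/\mu,2m),\langle g\rangle,X(q))$ exhibits the cyclic sieving phenomenon: for every primitive $2m$-th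 root of unity $\omega\in\mathbb C$ and every integer $d\ge 0$, $$\bigl|\{T\in SP(\lambda/\mu,2m)\mid g^dT=T\}\bigr|=X(\omega^d).$$ -/

import Mathlib

/-- The alphabet `1 < 2 < ⋯ < m < m̄ < ⋯ < 2̄ < 1̄`. The index `i : Fin m` is zero-based:
`pos i` is the letter `i + 1` and `bar i` is its barred counterpart. -/
inductive KNLetter (m : ℕ) : Type
  | pos (i : Fin m) : KNLetter m
  | bar (i : Fin m) : KNLetter m

namespace KNLetter

/-- Position of a letter in the ordered alphabet, counted from `0`. -/
def rank {m : ℕ} : KNLetter m → ℕ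
  | pos i => i.val
  | bar i => 2 * m - 1 - i.val

theorem rank_injective {m : ℕ} : Function.Injective (rank (m := m)) := by
  intro x y h
  cases x with
  | pos i =>
    cases y with
    | pos j => simp only [rank] at h; rw [Fin.ext h]
    | bar j => simp only [rank] at h; omega
  | bar i =>
    cases y with
    | pos j => simp only [rank] at h; omega
    | bar j =>
      simp only [rank] at h
      have : i = j := Fin.ext (by omega)
      rw [this]

theorem rank_lt {m : ℕ} (x : KNLetter m) : rank x < 2 * m := by
  cases x <;> simp only [rank] <;> omega

instance instLinearOrder {m : ℕ} : LinearOrder (KNLetter m) :=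
  LinearOrder.lift' rank rank_injective

instance instFinite {m : ℕ} : Finite (KNLetter m) :=
  Finite.of_injective (fun x : KNLetter m => (⟨rank x, rank_lt x⟩ : Fin (2 * m)))
    (fun _ _ h => rank_injective (Fin.mk.inj h))

end KNLetter

open KNLetter in
/-- The one-column condition: if `i` is in the `p`-th box from the top and `ī` in the `q`-th box
from the bottom of the (strictly increasing) column with set of entries `C`, then `p + q ≤ i`. -/
def AdmissibleColumn {m : ℕ} (C : Finset (KNLetter m)) : Prop :=
  ∀ i : Fin m, pos i ∈ C → bar i ∈ C →
    (C.filter (fun x => x ≤ pos i)).card + (C.filter (fun x => bar i ≤ x)).card ≤ i.val + 1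

open KNLetter in
/-- `t` is the splitting of the column `C`: if `z₁ > ⋯ > z_r` are the unbarred letters `z` with both
`z` and `z̄` in `C`, then `t z_k` is the greatest letter `s < z_k` with `s, s̄ ∉ C` and
`s < t z_l` for all `l < k`. The values of `t` at other letters are irrelevant. -/
def IsColumnSplitting {m : ℕ} (C : Finset (KNLetter m)) (t : Fin m → Fin m) : Prop :=
  ∀ z : Fin m, pos z ∈ C → bar z ∈ C →
    IsGreatest {s : Fin m | s < z ∧ pos s ∉ C ∧ bar s ∉ C ∧
      ∀ z' : Fin m, pos z' ∈ C → bar z' ∈ C → z < z' → s < t z'} (t z)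

open KNLetter in
/-- The left column `ℓC`: for each pair `z, z̄` in `C`, the letter `z` is replaced by `t z`. -/
def leftColumn {m : ℕ} (C : Finset (KNLetter m)) (t : Fin m → Fin m) : Finset (KNLetter m) :=
  C.image fun x => match x with
    | pos z => if bar z ∈ C then pos (t z) else pos z
    | bar z => bar z

open KNLetter in
/-- The right column `rC`: for each pair `z, z̄` in `C`, the letter `z̄` is replaced by the barred
counterpart of `t z`. -/
def rightColumn {m : ℕ} (C : Finset (KNLetter m)) (t : Fin m → Fin m) : Finset (KNLetter m) :=
  C.image fun x => match x with
    | pos z => pos z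
    | bar z => if pos z ∈ C then bar (t z) else bar z

/-- The boxes `(row, column)` of the skew shape `lam / mu`. -/
abbrev SkewCell (lam mu : YoungDiagram) : Type := {c : ℕ × ℕ // c ∈ lam.cells \ mu.cells}

/-- Fillings of the skew shape `lam / mu` with letters. -/
abbrev SkewFilling (lam mu : YoungDiagram) (m : ℕ) : Type := SkewCell lam mu → KNLetter m

/-- Entries strictly increase down columns. -/
def ColumnStrict {lam mu : YoungDiagram} {m : ℕ} (T : SkewFilling lam mu m) : Prop :=
  ∀ c d : SkewCell lam mu, c.1.2 = d.1.2 → c.1.1 < d.1.1 → T c < T d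

/-- Entries weakly increase along rows. -/
def RowWeak {lam mu : YoungDiagram} {m : ℕ} (T : SkewFilling lam mu m) : Prop :=
  ∀ c d : SkewCell lam mu, c.1.1 = d.1.1 → c.1.2 < d.1.2 → T c ≤ T d

/-- The set of entries of the `j`-th column. -/
def columnSet {lam mu : YoungDiagram} {m : ℕ} (T : SkewFilling lam mu m) (j : ℕ) :
    Finset (KNLetter m) :=
  (Finset.univ.filter (fun c : SkewCell lam mu => c.1.2 = j)).image T

/-- The split form of `T` replaces each column `C` by the two columns `ℓC rC` (each rearranged in
increasing order, in the same rows as `C`). It is recorded by the filling `L` with columns `ℓC`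
and the filling `R` with columns `rC`. -/
structure IsSplitForm {lam mu : YoungDiagram} {m : ℕ} (T L R : SkewFilling lam mu m) : Prop where
  left_strict : ColumnStrict L
  right_strict : ColumnStrict R
  columns : ∀ j : ℕ, ∃ t : Fin m → Fin m, IsColumnSplitting (columnSet T j) t ∧
    columnSet L j = leftColumn (columnSet T j) t ∧
    columnSet R j = rightColumn (columnSet T j) t

/-- The rows of the split form `⋯ ℓC rC ℓC' rC' ⋯` are weakly increasing. -/
def SplitRowWeak {lam mu : YoungDiagram} {m : ℕ} (L R : SkewFilling lam mu m) : Prop :=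
  (∀ c : SkewCell lam mu, L c ≤ R c) ∧
    ∀ c d : SkewCell lam mu, c.1.1 = d.1.1 → c.1.2 < d.1.2 → R c ≤ L d

/-- Kashiwara–Nakashima skew symplectic tableaux: semistandard skew tableaux all of whose columns
are admissible and whose split form is semistandard. -/
structure IsKNSkewTableau {lam mu : YoungDiagram} {m : ℕ} (T : SkewFilling lam mu m) : Prop where
  row_weak : RowWeak T
  column_strict : ColumnStrict T
  admissible : ∀ j : ℕ, AdmissibleColumn (columnSet T j)
  split : ∃ L R : SkewFilling lam mu m, IsSplitForm T L R ∧ SplitRowWeak L R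

/-- The set `SP(lam / mu, 2m)` of KN skew symplectic tableaux. -/
def SP (lam mu : YoungDiagram) (m : ℕ) : Type :=
  {T : SkewFilling lam mu m // IsKNSkewTableau T}

namespace SP

instance instFinite {lam mu : YoungDiagram} {m : ℕ} : Finite (SP lam mu m) :=
  inferInstanceAs (Finite {T : SkewFilling lam mu m // IsKNSkewTableau T})

noncomputable instance instFintype {lam mu : YoungDiagram} {m : ℕ} : Fintype (SP lam mu m) :=
  Fintype.ofFinite _

/-- The number `a_x` of entries of `T` equal to the letter `x`. -/
def count {lam mu : YoungDiagram} {m : ℕ} (T : SP lam mu m) (x : KNLetter m) : ℕ :=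
  (Finset.univ.filter (fun c : SkewCell lam mu => T.1 c = x)).card

/-- The weight `χ_i = a_i - a_ī`. -/
def wt {lam mu : YoungDiagram} {m : ℕ} (T : SP lam mu m) : Fin m → ℤ :=
  fun i => (T.count (KNLetter.pos i) : ℤ) - (T.count (KNLetter.bar i) : ℤ)

/-- `pwr T = ∑_{i=1}^m ((i - 1) a_i + (2m - i) a_ī)`; the summation index below is `i - 1`. -/
def pwr {lam mu : YoungDiagram} {m : ℕ} (T : SP lam mu m) : ℕ :=
  ∑ i : Fin m, (i.val * T.count (KNLetter.pos i) +
    (2 * m - (i.val + 1)) * T.count (KNLetter.bar i))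

/-- The generating polynomial `X(q) = ∑_T q^{pwr T}`. -/
noncomputable def genPoly (lam mu : YoungDiagram) (m : ℕ) : Polynomial ℤ :=
  ∑ T : SP lam mu m, Polynomial.X ^ T.pwr

end SP

/-- `(χ_1, …, χ_m) ↦ (-χ_m, χ_1, …, χ_{m-1})`. -/
def signedShift {m : ℕ} (χ : Fin m → ℤ) : Fin m → ℤ := fun i =>
  if i.val = 0 then -χ ⟨m - 1, Nat.sub_one_lt_of_lt i.isLt⟩
  else χ ⟨i.val - 1, lt_of_le_of_lt (Nat.sub_le i.val 1) i.isLt⟩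

/-- For a finite cyclic group `G` with generator `g` acting on the finite set `X`, the triple
`(X, ⟨g⟩, f)` exhibits the cyclic sieving phenomenon: if `ω` is a primitive `|G|`-th root of unity,
then `g ^ d` has exactly `f(ω ^ d)` fixed points for all `d ≥ 0`. -/
def ExhibitsCSP (X : Type*) [Finite X] {G : Type*} [Group G] [MulAction G X] (g : G)
    (f : Polynomial ℤ) : Prop :=
  ∀ ω : ℂ, IsPrimitiveRoot ω (Nat.card G) → ∀ d : ℕ,
    (Nat.card {x : X // g ^ d • x = x} : ℂ) = Polynomial.aeval (ω ^ d) f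

/-!
Both sides depend on the weights only. With `η ^ 2 = ω ^ d` and `x_i = η ^ (2 i - 1)`, the number
`η ^ n * X(ω ^ d)` is the sum of the monomials `∏ i, x_i ^ (wt T)_i` over all tableaux `T`
(`SP.prod_zpow_wt`). The case `ω ^ d = 1` is clear; otherwise both sides vanish.

*Fixed points.* A fixed point of `g ^ d` is fixed by a power of `g` of prime order `q`, so its
weight is fixed by a power of the signed shift of order `q`. For `q = 2` the weight equals its
negative, so it is zero, although its coordinates have odd sum. For `q` odd, the absolute values
of the coordinates are repeated `q` times, so `q` divides `m` and a positive number at most `n`,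
against the hypothesis (`iterate_signedShift_ne`).

*Symmetry.* The multiset of weights is stable under the hyperoctahedral group. The signed shift is
given by `g`; its `m`-th power is the negation. Together with the transposition of the first two
coordinates, it generates the whole group (`map_comp_perm_eq`, `map_flipSigns_eq`). For the
transposition, the crystal operator `f₁` is used: the letters `1, 2, 2̄, 1̄` get the signs
`+, -, +, -`, the entries are read column by column from right to left, and `f₁` lowers the letter
with the first plus sign which survives the cancellation of `+-`, replacing `1` by `2` or `2̄` by
`1̄`. It is injective, so iterating it shows that `χ` occurs at most as often as its transpose if
`χ₂ ≤ χ₁` (`ncard_weight_le`); the opposite inequality follows by negation. The point is that `f₁`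
preserves Kashiwara–Nakashima tableaux (`IsKNSkewTableau.update_lower`). Its effect on the split
form of the column concerned is that each of `ℓC`, `rC` is either unchanged, or has all its
letters `1` and `2̄` lowered (`IsColumnSplitting.lower`). This could violate only the inequality
between `rC` and the next column `ℓC'`. But if `rC` changes, then no minus sign of `C` precedes
the first surviving plus sign, so each `1` and `2̄` in `ℓC'` is followed by `2` or `1̄`,
respectively, and comparing this letter with its neighbour in `rC` excludes a violation
(`lower_le_of_next`).

*Vanishing.* By the symmetry, the sum of the monomials is a combination of orbit sums of odd
degree at most `n`. These are polynomials in the power sums `∑ i, (x_i ^ a + x_i ^ (-a))`, and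
each product of power sums that occurs has a factor with `a` odd and at most `n`
(`orbitSum_eq_zero`). Such a power sum vanishes as `(ω ^ d) ^ a ≠ 1`, by the hypothesis on the odd
primes up to `n` (`sum_odd_powers_eq_zero`, `zpow_ne_one_of_odd`).
-/

/-! ### Signatures -/

section Signature

open Finset

variable {ι κ α V : Type*} [LinearOrder κ]

/-- The sequence `w`, read in the order of `key`, has a final segment of sum at least `j`. For a
sequence of signs this says that at least `j` plus signs survive the cancellation of `+-`. -/
def HasSuffix (key : ι → κ) (w : ι → ℤ) (j : ℤ) : Prop :=
  ∃ U : Finset ι, (∀ c ∈ U, ∀ d, key c ≤ key d → d ∈ U) ∧ j ≤ ∑ c ∈ U, w c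

/-- `p` is the position of the first plus sign which survives the cancellation of `+-` in the
sequence of signs `w`, read in the order of `key`: segments that start at `p` have positive sum, and
segments that end just before `p` have nonpositive sum. -/
structure IsFirstUnmatched (key : ι → κ) (w : ι → ℤ) (p : ι) : Prop where
  sum_pos : ∀ V : Finset ι, p ∈ V → (∀ c ∈ V, key p ≤ key c) →
    (∀ c ∈ V, ∀ d, key p ≤ key d → key d ≤ key c → d ∈ V) → 0 < ∑ c ∈ V, w c
  sum_nonpos : ∀ V : Finset ι, (∀ c ∈ V, key c < key p) →
    (∀ c ∈ V, ∀ d, key c ≤ key d → key d < key p → d ∈ V) → ∑ c ∈ V, w c ≤ 0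

variable {key : ι → κ} {w : ι → ℤ}

theorem IsFirstUnmatched.apply_pos (hkey : Function.Injective key) {p : ι}
    (h : IsFirstUnmatched key w p) : 0 < w p := by
  have := h.sum_pos {p} (by simp) (by simp) (by
    intro c hc d h1 h2
    rw [mem_singleton] at hc ⊢
    subst hc
    exact hkey (le_antisymm h2 h1))
  simpa using this

variable [Fintype ι] [DecidableEq ι]

/-- The first surviving plus sign starts the shortest final segment of maximal sum. -/
theorem HasSuffix.exists_isFirstUnmatched (hkey : Function.Injective key) (hw : ∀ c, w c ≤ 1)
    {j : ℤ} (hj : 0 ≤ j) (h : HasSuffix key w (j + 1)) :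
    ∃ p, IsFirstUnmatched key w p ∧ HasSuffix key (Function.update w p (-1)) j := by
  classical
  obtain ⟨U₀, hU₀, hs₀⟩ := h
  obtain ⟨U, hU, hmax⟩ := Finset.exists_max_image
    ((univ : Finset (Finset ι)).filter fun U => ∀ c ∈ U, ∀ d, key c ≤ key d → d ∈ U)
    (fun U => toLex (∑ c ∈ U, w c, -(U.card : ℤ))) ⟨U₀, by simpa using hU₀⟩
  simp only [mem_filter, mem_univ, true_and, Prod.Lex.le_iff, ofLex_toLex] at hU hmax
  have hsum : ∀ U' : Finset ι, (∀ c ∈ U', ∀ d, key c ≤ key d → d ∈ U') →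
      ∑ c ∈ U', w c ≤ ∑ c ∈ U, w c := fun U' h' => by
    rcases hmax U' h' with h | h
    · exact h.le
    · exact h.1.le
  have hUs : j + 1 ≤ ∑ c ∈ U, w c := hs₀.trans (hsum U₀ hU₀)
  have hne : U.Nonempty := by
    rw [nonempty_iff_ne_empty]
    rintro rfl
    simp at hUs
    omega
  obtain ⟨p, hpU, hp⟩ := Finset.exists_min_image U key hne
  have hmem : ∀ c, c ∈ U ↔ key p ≤ key c := fun c => ⟨hp c, hU p hpU c⟩
  have hfirst : IsFirstUnmatched key w p := by
    constructor
    · intro V hpV hV hV'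
      have hsub : V ⊆ U := fun c hc => (hmem c).2 (hV c hc)
      have hup : ∀ c ∈ U \ V, ∀ d, key c ≤ key d → d ∈ U \ V := by
        intro c hc d hcd
        rw [mem_sdiff] at hc ⊢
        refine ⟨hU c hc.1 d hcd, fun hd => hc.2 (hV' d hd c ((hmem c).1 hc.1) hcd)⟩
      have hcard : (U \ V).card < U.card :=
        card_lt_card ⟨sdiff_subset, fun hh => (mem_sdiff.1 (hh hpU)).2 hpV⟩
      have hadd := sum_sdiff (f := w) hsub
      rcases hmax _ hup with h | h
      · linarith
      · have := h.2
        omega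
    · intro V hV hV'
      have hdisj : Disjoint U V := by
        rw [disjoint_left]
        intro c hc hc'
        exact absurd (hV c hc') (not_lt.2 ((hmem c).1 hc))
      have hup : ∀ c ∈ U ∪ V, ∀ d, key c ≤ key d → d ∈ U ∪ V := by
        intro c hc d hcd
        rw [mem_union] at hc ⊢
        rcases hc with hc | hc
        · exact Or.inl (hU c hc d hcd)
        · rcases le_or_gt (key p) (key d) with h | h
          · exact Or.inl ((hmem d).2 h)
          · exact Or.inr (hV' c hc d hcd h)
      have := hsum _ hup
      rw [sum_union hdisj] at this
      linarith
  refine ⟨p, hfirst, U.erase p, ?_, ?_⟩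
  · intro c hc d hcd
    rw [mem_erase] at hc ⊢
    refine ⟨?_, hU c hc.2 d hcd⟩
    rintro rfl
    exact hc.1 (hkey (le_antisymm hcd (hp c hc.2)))
  · have h1 := sum_erase_add U w hpU
    have h2 : ∑ c ∈ U.erase p, Function.update w p (-1) c = ∑ c ∈ U.erase p, w c :=
      sum_congr rfl fun c hc => Function.update_of_ne (ne_of_mem_erase hc) _ _
    have := hw p
    rw [h2]
    linarith

/-- The position of the sign that was changed can be recovered from the changed sequence, as the
last minus sign which survives the cancellation. -/
theorem IsFirstUnmatched.eq_of_update_eq (hkey : Function.Injective key) {w' : ι → ℤ} {p p' : ι}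
    (hw : ∀ c, w c ≤ 1) (h : IsFirstUnmatched key w p) (h' : IsFirstUnmatched key w' p')
    (heq : Function.update w p (-1) = Function.update w' p' (-1)) : ¬ key p < key p' := by
  classical
  intro hlt
  have hne : p ≠ p' := fun h => by simp [h] at hlt
  have hpp : w p' = -1 := by
    have := congrFun heq p'
    rwa [Function.update_of_ne hne.symm, Function.update_self] at this
  set I : Finset ι := univ.filter fun c => key p < key c ∧ key c < key p' with hI
  have h1 := h.sum_pos (insert p (insert p' I)) (by simp) (by
      simp only [mem_insert, hI, mem_filter, mem_univ, true_and]
      rintro c (rfl | rfl | hc)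
      exacts [le_rfl, hlt.le, hc.1.le]) (by
      intro c hc d h1 h2
      simp only [mem_insert, hI, mem_filter, mem_univ, true_and] at hc ⊢
      have hd : key d ≤ key p' := by
        rcases hc with rfl | rfl | hc
        exacts [h2.trans hlt.le, h2, h2.trans hc.2.le]
      rcases h1.eq_or_lt with h3 | h3
      · exact Or.inl (hkey h3.symm)
      · rcases hd.eq_or_lt with h4 | h4
        · exact Or.inr (Or.inl (hkey h4))
        · exact Or.inr (Or.inr ⟨h3, h4⟩))
  have h2 := h'.sum_nonpos I (by simp [hI]) (by
      intro c hc d h1 h2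
      simp only [hI, mem_filter, mem_univ, true_and] at hc ⊢
      exact ⟨hc.1.trans_le h1, h2⟩)
  have h3 : ∑ c ∈ I, w c = ∑ c ∈ I, w' c := by
    refine sum_congr rfl fun c hc => ?_
    simp only [hI, mem_filter, mem_univ, true_and] at hc
    have := congrFun heq c
    rwa [Function.update_of_ne, Function.update_of_ne] at this
    · rintro rfl
      exact hc.2.false
    · rintro rfl
      exact hc.1.false
  rw [sum_insert, sum_insert, hpp, h3] at h1
  · have := hw p
    linarith
  · simp [hI]
  · simp [hI, hne]

/-- A set of fillings which is stable under changing the first surviving plus sign has at least as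
many elements of weight `χ - j • a` as it has elements of weight `χ` with `j` surviving plus
signs. -/
theorem ncard_weight_le [Finite α] [AddCommGroup V] (hkey : Function.Injective key) (sgn : α → ℤ)
    (lower : α → α) (wt : α → V) (a : V) (hsgn : ∀ x, sgn x ≤ 1)
    (hlower : ∀ x, sgn x = 1 → sgn (lower x) = -1)
    (hinj : Set.InjOn lower {x | sgn x = 1})
    (hwt : ∀ x, sgn x = 1 → wt (lower x) = wt x - a)
    (S : Set (ι → α)) (hS : ∀ T ∈ S, ∀ p, IsFirstUnmatched key (sgn ∘ T) p →
      Function.update T p (lower (T p)) ∈ S) (j : ℕ) (χ : V) :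
    {T ∈ S | ∑ c, wt (T c) = χ ∧ HasSuffix key (sgn ∘ T) j}.ncard ≤
      {T ∈ S | ∑ c, wt (T c) = χ - j • a}.ncard := by
  classical
  induction j generalizing χ with
  | zero =>
    refine Set.ncard_le_ncard ?_ (Set.toFinite _)
    rintro T ⟨h1, h2, -⟩
    exact ⟨h1, by simpa using h2⟩
  | succ j ih =>
    refine le_trans ?_ ((ih (χ - a)).trans (le_of_eq ?_))
    · have hex : ∀ T : ι → α, HasSuffix key (sgn ∘ T) (j + 1 : ℕ) →
          ∃ p, IsFirstUnmatched key (sgn ∘ T) p ∧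
            HasSuffix key (Function.update (sgn ∘ T) p (-1)) j := fun T hT =>
        HasSuffix.exists_isFirstUnmatched hkey (fun c => hsgn _) (Nat.cast_nonneg j)
          (by exact_mod_cast hT)
      rcases isEmpty_or_nonempty ι with hι | hι
      · refine (Set.ncard_le_ncard (t := ∅) ?_).trans (by simp)
        rintro T ⟨-, -, hT⟩
        exact hι.elim (hex T hT).choose
      choose! p hp hp' using hex
      have hone : ∀ T, HasSuffix key (sgn ∘ T) (j + 1 : ℕ) → sgn (T (p T)) = 1 := fun T hT =>
        le_antisymm (hsgn _) ((hp T hT).apply_pos hkey)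
      have hupd : ∀ T, HasSuffix key (sgn ∘ T) (j + 1 : ℕ) →
          sgn ∘ Function.update T (p T) (lower (T (p T))) =
            Function.update (sgn ∘ T) (p T) (-1) := fun T hT => by
        rw [Function.comp_update, hlower _ (hone T hT)]
      refine Set.ncard_le_ncard_of_injOn (fun T => Function.update T (p T) (lower (T (p T)))) ?_ ?_
        (Set.toFinite _)
      · rintro T ⟨hT, hχ, hsuf⟩
        refine ⟨hS T hT _ (hp T hsuf), ?_, ?_⟩
        · have h1 : ∀ c, wt (Function.update T (p T) (lower (T (p T))) c) =
              wt (T c) - if c = p T then a else 0 := by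
            intro c
            by_cases hc : c = p T
            · subst hc
              simp [hwt _ (hone T hsuf)]
            · simp [hc]
          simp only [h1, sum_sub_distrib, hχ]
          simp
        · rw [hupd T hsuf]
          exact hp' T hsuf
      · rintro T ⟨-, -, hT⟩ T' ⟨-, -, hT'⟩ heq
        simp only at heq
        have hw : Function.update (sgn ∘ T) (p T) (-1) =
            Function.update (sgn ∘ T') (p T') (-1) := by
          rw [← hupd T hT, ← hupd T' hT', heq]
        have hpp : p T = p T' := by
          refine hkey (le_antisymm (not_lt.1 ?_) (not_lt.1 ?_))
          · exact (hp T' hT').eq_of_update_eq hkey (fun c => hsgn _) (hp T hT) hw.symm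
          · exact (hp T hT).eq_of_update_eq hkey (fun c => hsgn _) (hp T' hT') hw
        funext c
        by_cases hc : c = p T
        · have := congrFun heq (p T)
          rw [Function.update_self, hpp, Function.update_self] at this
          rw [hc, hpp]
          exact hinj (hpp ▸ hone T hT) (hone T' hT') this
        · have := congrFun heq c
          rwa [Function.update_of_ne hc, Function.update_of_ne (hpp ▸ hc)] at this
    · rw [succ_nsmul', sub_sub]

end Signature

/-! ### Split columns -/

section Columns

open KNLetter

variable {m : ℕ} {C C' : Finset (KNLetter m)} {t : Fin m → Fin m}

namespace KNLetter

theorem le_iff_rank {x y : KNLetter m} : x ≤ y ↔ rank x ≤ rank y := Iff.rfl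

theorem lt_iff_rank {x y : KNLetter m} : x < y ↔ rank x < rank y := Iff.rfl

end KNLetter

theorem pos_mem_leftColumn {s : Fin m} : pos s ∈ leftColumn C t ↔
    (pos s ∈ C ∧ bar s ∉ C) ∨ ∃ z, pos z ∈ C ∧ bar z ∈ C ∧ t z = s := by
  simp only [leftColumn, Finset.mem_image]
  constructor
  · rintro ⟨z | z, hz, h⟩
    · simp only at h
      split_ifs at h with h'
      · exact Or.inr ⟨z, hz, h', by simpa using h⟩
      · cases h
        exact Or.inl ⟨hz, h'⟩
    · cases h
  · rintro (⟨h1, h2⟩ | ⟨z, h1, h2, rfl⟩)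
    · exact ⟨_, h1, by simp [h2]⟩
    · exact ⟨_, h1, by simp [h2]⟩

theorem bar_mem_leftColumn {s : Fin m} : bar s ∈ leftColumn C t ↔ bar s ∈ C := by
  simp only [leftColumn, Finset.mem_image]
  constructor
  · rintro ⟨z | z, hz, h⟩
    · simp only at h
      split_ifs at h
    · cases h
      exact hz
  · exact fun h => ⟨_, h, rfl⟩

theorem pos_mem_rightColumn {s : Fin m} : pos s ∈ rightColumn C t ↔ pos s ∈ C := by
  simp only [rightColumn, Finset.mem_image]
  constructor
  · rintro ⟨z | z, hz, h⟩
    · cases h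
      exact hz
    · simp only at h
      split_ifs at h
  · exact fun h => ⟨_, h, rfl⟩

theorem bar_mem_rightColumn {s : Fin m} : bar s ∈ rightColumn C t ↔
    (bar s ∈ C ∧ pos s ∉ C) ∨ ∃ z, pos z ∈ C ∧ bar z ∈ C ∧ t z = s := by
  simp only [rightColumn, Finset.mem_image]
  constructor
  · rintro ⟨z | z, hz, h⟩
    · cases h
    · simp only at h
      split_ifs at h with h'
      · exact Or.inr ⟨z, h', hz, by simpa using h⟩
      · cases h
        exact Or.inl ⟨hz, h'⟩
  · rintro (⟨h1, h2⟩ | ⟨z, h2, h1, rfl⟩)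
    · exact ⟨_, h1, by simp [h2]⟩
    · exact ⟨_, h1, by simp [h2]⟩

/-- The splitting of a column is not affected when the two least letters `x`, `y`, one of them
free and the other not, and neither of them in a pair, exchange their roles. -/
theorem IsColumnSplitting.exchange (ht : IsColumnSplitting C t) {x y : Fin m}
    (hxy : ∀ s, s ≠ x → s ≠ y → x < s ∧ y < s)
    (hrest : ∀ s, s ≠ x → s ≠ y → (pos s ∈ C' ↔ pos s ∈ C) ∧ (bar s ∈ C' ↔ bar s ∈ C))
    (hy : pos y ∈ C ∧ bar y ∉ C ∨ pos y ∉ C ∧ bar y ∈ C)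
    (hx : pos x ∉ C ∧ bar x ∉ C)
    (hx' : pos x ∈ C' ∧ bar x ∉ C' ∨ pos x ∉ C' ∧ bar x ∈ C')
    (hy' : pos y ∉ C' ∧ bar y ∉ C') :
    IsColumnSplitting C' (fun z => if t z = x then y else t z) := by
  intro z hz1 hz2
  have hzx : z ≠ x := by rintro rfl; tauto
  have hzy : z ≠ y := by rintro rfl; tauto
  have hzlt := hxy z hzx hzy
  have hpair : ∀ z', pos z' ∈ C' → bar z' ∈ C' → z' ≠ x ∧ z' ≠ y ∧ pos z' ∈ C ∧ bar z' ∈ C := by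
    intro z' h1 h2
    have hx1 : z' ≠ x := by rintro rfl; tauto
    have hy1 : z' ≠ y := by rintro rfl; tauto
    exact ⟨hx1, hy1, ((hrest z' hx1 hy1).1).1 h1, ((hrest z' hx1 hy1).2).1 h2⟩
  have hne : ∀ z', pos z' ∈ C' → bar z' ∈ C' → t z' ≠ y := by
    intro z' h1 h2 h
    have := (ht z' (hpair z' h1 h2).2.2.1 (hpair z' h1 h2).2.2.2).1.2
    rw [h] at this
    tauto
  obtain ⟨-, -, hz3, hz4⟩ := hpair z hz1 hz2
  obtain ⟨⟨h1, h2, h3, h4⟩, h5⟩ := ht z hz3 hz4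
  refine ⟨⟨?_, ?_, ?_, ?_⟩, ?_⟩
  · dsimp only
    split_ifs
    exacts [hzlt.2, h1]
  · dsimp only
    split_ifs with h
    exacts [hy'.1, fun hh => h2 (((hrest _ h (hne z hz1 hz2)).1).1 hh)]
  · dsimp only
    split_ifs with h
    exacts [hy'.2, fun hh => h3 (((hrest _ h (hne z hz1 hz2)).2).1 hh)]
  · intro z' hz1' hz2' hlt
    have h6 := h4 z' (hpair z' hz1' hz2').2.2.1 (hpair z' hz1' hz2').2.2.2 hlt
    have h7 : t z' ≠ x := by
      intro h
      rw [h] at h6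
      exact absurd h6 (not_lt.2 (hxy _ h6.ne (hne z hz1 hz2)).1.le)
    dsimp only
    rw [if_neg h7]
    split_ifs
    exacts [(hxy _ h7 (hne z' hz1' hz2')).2, h6]
  · rintro s ⟨hs1, hs2, hs3, hs4⟩
    dsimp only at hs4 ⊢
    by_cases hsy : s = y
    · subst hsy
      split_ifs with h
      exacts [le_rfl, (hxy _ h (hne z hz1 hz2)).2.le]
    have hsx : s ≠ x := by rintro rfl; tauto
    have hs := hxy s hsx hsy
    have hst : s ≤ t z := by
      refine h5 ⟨hs1, fun h => hs2 (((hrest s hsx hsy).1).2 h),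
        fun h => hs3 (((hrest s hsx hsy).2).2 h), ?_⟩
      intro z' h6 h7 h8
      have hx1 : z' ≠ x := (hzlt.1.trans h8).ne'
      have hy1 : z' ≠ y := (hzlt.2.trans h8).ne'
      have := hs4 z' (((hrest z' hx1 hy1).1).2 h6) (((hrest z' hx1 hy1).2).2 h7) h8
      split_ifs at this
      exacts [absurd this (not_lt.2 hs.2.le), this]
    split_ifs with h
    · exact absurd (h ▸ hst) (not_le.2 hs.1)
    · exact hst

/-- A pair at the second letter is split by the first letter. -/
theorem IsColumnSplitting.create_pair (ht : IsColumnSplitting C t) {i₀ i₁ : Fin m}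
    (h₀ : i₀.val = 0) (h₁ : i₁.val = 1)
    (hrest : ∀ s, s ≠ i₀ → s ≠ i₁ → (pos s ∈ C' ↔ pos s ∈ C) ∧ (bar s ∈ C' ↔ bar s ∈ C))
    (ha : pos i₀ ∈ C) (hb' : bar i₁ ∈ C) (ha' : bar i₀ ∉ C)
    (hA : pos i₀ ∉ C') (hA' : bar i₀ ∉ C') :
    IsColumnSplitting C' (fun z => if z = i₁ then i₀ else t z) := by
  have hle : ∀ s : Fin m, i₀ ≤ s := fun s => by rw [Fin.le_def]; omega
  have hle' : ∀ s : Fin m, s ≠ i₀ → i₁ ≤ s := fun s hs => by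
    rw [Ne, Fin.ext_iff] at hs; rw [Fin.le_def]; omega
  have h01 : i₀ < i₁ := by rw [Fin.lt_def]; omega
  have hpair : ∀ z', pos z' ∈ C' → bar z' ∈ C' → z' ≠ i₁ →
      i₁ < z' ∧ z' ≠ i₀ ∧ pos z' ∈ C ∧ bar z' ∈ C := by
    intro z' h1 h2 h3
    have h4 : z' ≠ i₀ := by rintro rfl; tauto
    exact ⟨lt_of_le_of_ne (hle' _ h4) h3.symm, h4, ((hrest z' h4 h3).1).1 h1,
      ((hrest z' h4 h3).2).1 h2⟩
  have hne : ∀ z', pos z' ∈ C' → bar z' ∈ C' → z' ≠ i₁ → t z' ≠ i₀ ∧ t z' ≠ i₁ := by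
    intro z' h1 h2 h3
    obtain ⟨-, -, h4, h5⟩ := hpair z' h1 h2 h3
    obtain ⟨-, h6, h7, -⟩ := (ht z' h4 h5).1
    constructor <;> intro h <;> rw [h] at h6 h7 <;> tauto
  intro z hz1 hz2
  by_cases hz : z = i₁
  · subst hz
    simp only [if_true]
    refine ⟨⟨h01, hA, hA', ?_⟩, ?_⟩
    · intro z' h1 h2 h3
      rw [if_neg h3.ne']
      exact lt_of_le_of_ne (hle _) (hne z' h1 h2 h3.ne').1.symm
    · rintro s ⟨hs, -⟩
      rw [Fin.lt_def] at hs
      rw [Fin.le_def]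
      omega
  · obtain ⟨hz3, hz4, hz5, hz6⟩ := hpair z hz1 hz2 hz
    obtain ⟨⟨h1, h2, h3, h4⟩, h5⟩ := ht z hz5 hz6
    obtain ⟨h6, h7⟩ := hne z hz1 hz2 hz
    simp only [if_neg hz]
    refine ⟨⟨h1, fun h => h2 (((hrest _ h6 h7).1).1 h), fun h => h3 (((hrest _ h6 h7).2).1 h),
      ?_⟩, ?_⟩
    · intro z' h8 h9 h10
      have h11 : z' ≠ i₁ := (hz3.trans h10).ne'
      obtain ⟨-, -, h12, h13⟩ := hpair z' h8 h9 h11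
      rw [if_neg h11]
      exact h4 z' h12 h13 h10
    · rintro s ⟨hs1, hs2, hs3, hs4⟩
      by_cases hs5 : s = i₀
      · rw [hs5]
        exact hle _
      by_cases hs6 : s = i₁
      · rw [hs6]
        exact hle' _ h6
      refine h5 ⟨hs1, fun h => hs2 (((hrest s hs5 hs6).1).2 h),
        fun h => hs3 (((hrest s hs5 hs6).2).2 h), ?_⟩
      intro z' h8 h9 h10
      have h11 : z' ≠ i₁ := (hz3.trans h10).ne'
      have h12 : z' ≠ i₀ := ((h01.trans hz3).trans h10).ne'
      have := hs4 z' (((hrest z' h12 h11).1).2 h8) (((hrest z' h12 h11).2).2 h9) h10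
      rwa [if_neg h11] at this

/-- When the pair at the second letter disappears, the splitting of the other pairs persists. -/
theorem IsColumnSplitting.remove_pair (ht : IsColumnSplitting C t) {i₀ i₁ : Fin m}
    (h₀ : i₀.val = 0) (h₁ : i₁.val = 1)
    (hrest : ∀ s, s ≠ i₀ → s ≠ i₁ → (pos s ∈ C' ↔ pos s ∈ C) ∧ (bar s ∈ C' ↔ bar s ∈ C))
    (hb : pos i₁ ∈ C) (hb' : bar i₁ ∈ C)
    (hA : pos i₀ ∉ C') (hA' : bar i₀ ∈ C') (hB : pos i₁ ∈ C') (hB' : bar i₁ ∉ C') :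
    IsColumnSplitting C' t := by
  have hle : ∀ s : Fin m, i₀ ≤ s := fun s => by rw [Fin.le_def]; omega
  have hle' : ∀ s : Fin m, s ≠ i₀ → i₁ ≤ s := fun s hs => by
    rw [Ne, Fin.ext_iff] at hs; rw [Fin.le_def]; omega
  have hpair : ∀ z', pos z' ∈ C' → bar z' ∈ C' →
      i₁ < z' ∧ z' ≠ i₀ ∧ z' ≠ i₁ ∧ pos z' ∈ C ∧ bar z' ∈ C := by
    intro z' h1 h2
    have h4 : z' ≠ i₀ := by rintro rfl; tauto
    have h3 : z' ≠ i₁ := by rintro rfl; tauto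
    exact ⟨lt_of_le_of_ne (hle' _ h4) h3.symm, h4, h3, ((hrest z' h4 h3).1).1 h1,
      ((hrest z' h4 h3).2).1 h2⟩
  intro z hz1 hz2
  obtain ⟨hz3, hz4, hz7, hz5, hz6⟩ := hpair z hz1 hz2
  obtain ⟨⟨h1, h2, h3, h4⟩, h5⟩ := ht z hz5 hz6
  have h6 : t z ≠ i₀ := by
    obtain ⟨⟨-, -, -, h8⟩, -⟩ := ht i₁ hb hb'
    exact ((hle _).trans_lt (h8 z hz5 hz6 hz3)).ne'
  have h7 : t z ≠ i₁ := by intro h; rw [h] at h2; tauto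
  refine ⟨⟨h1, fun h => h2 (((hrest _ h6 h7).1).1 h), fun h => h3 (((hrest _ h6 h7).2).1 h),
      ?_⟩, ?_⟩
  · intro z' h8 h9 h10
    obtain ⟨-, -, -, h12, h13⟩ := hpair z' h8 h9
    exact h4 z' h12 h13 h10
  · rintro s ⟨hs1, hs2, hs3, hs4⟩
    have hs5 : s ≠ i₀ := by rintro rfl; tauto
    have hs6 : s ≠ i₁ := by rintro rfl; tauto
    refine h5 ⟨hs1, fun h => hs2 (((hrest s hs5 hs6).1).2 h),
      fun h => hs3 (((hrest s hs5 hs6).2).2 h), ?_⟩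
    intro z' h8 h9 h10
    have h11 : z' ≠ i₁ := (hz3.trans h10).ne'
    have h12 : z' ≠ i₀ := ((hle _).trans_lt h10).ne'
    exact hs4 z' (((hrest z' h12 h11).1).2 h8) (((hrest z' h12 h11).2).2 h9) h10

namespace KNLetter

/-- The signature of a letter for the simple root `ε_i - ε_j`. -/
def sign (i j : Fin m) : KNLetter m → ℤ
  | pos s => if s = i then 1 else if s = j then -1 else 0
  | bar s => if s = j then 1 else if s = i then -1 else 0

/-- The lowering operator for the simple root `ε_i - ε_j`: it maps `i` to `j` and `j̄` to `ī`, and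
is extended by the identity. -/
def lower (i j : Fin m) : KNLetter m → KNLetter m
  | pos s => if s = i then pos j else pos s
  | bar s => if s = j then bar i else bar s

end KNLetter

/-- `X'` is obtained from the set `X`, which contains neither `j` nor `ī`, by lowering all of its
letters. -/
def IsLowered (i j : Fin m) (X X' : Finset (KNLetter m)) : Prop :=
  X' = X.image (lower i j) ∧ pos j ∉ X ∧ bar i ∉ X

theorem isLowered_of_mem_iff {i j : Fin m} (hij : i ≠ j) {X X' : Finset (KNLetter m)}
    (hj : pos j ∉ X) (hi : bar i ∉ X)
    (hrest : ∀ s, s ≠ i → s ≠ j → (pos s ∈ X' ↔ pos s ∈ X) ∧ (bar s ∈ X' ↔ bar s ∈ X))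
    (h1 : pos i ∉ X') (h2 : bar j ∉ X') (h3 : pos j ∈ X' ↔ pos i ∈ X)
    (h4 : bar i ∈ X' ↔ bar j ∈ X) : IsLowered i j X X' := by
  refine ⟨?_, hj, hi⟩
  ext x
  rw [Finset.mem_image]
  constructor
  · intro hx
    rcases x with s | s
    · by_cases hs : s = j
      · subst hs
        exact ⟨pos i, h3.1 hx, by simp [lower]⟩
      · have hsi : s ≠ i := by rintro rfl; tauto
        exact ⟨pos s, (hrest s hsi hs).1.1 hx, by simp [lower, hsi]⟩
    · by_cases hs : s = i
      · subst hs
        exact ⟨bar j, h4.1 hx, by simp [lower]⟩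
      · have hsj : s ≠ j := by rintro rfl; tauto
        exact ⟨bar s, (hrest s hs hsj).2.1 hx, by simp [lower, hsj]⟩
  · rintro ⟨y, hy, rfl⟩
    rcases y with s | s
    · by_cases hs : s = i
      · subst hs
        simpa [lower] using h3.2 hy
      · have hsj : s ≠ j := by rintro rfl; tauto
        simpa [lower, hs] using (hrest s hs hsj).1.2 hy
    · by_cases hs : s = j
      · subst hs
        simpa [lower] using h4.2 hy
      · have hsi : s ≠ i := by rintro rfl; tauto
        simpa [lower, hs] using (hrest s hsi hs).2.2 hy

variable {t' : Fin m → Fin m}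

theorem letters_ext {i j : Fin m} {X X' : Finset (KNLetter m)}
    (hrest : ∀ s, s ≠ i → s ≠ j → (pos s ∈ X' ↔ pos s ∈ X) ∧ (bar s ∈ X' ↔ bar s ∈ X))
    (h1 : pos i ∈ X' ↔ pos i ∈ X) (h2 : bar i ∈ X' ↔ bar i ∈ X)
    (h3 : pos j ∈ X' ↔ pos j ∈ X) (h4 : bar j ∈ X' ↔ bar j ∈ X) : X' = X := by
  ext x
  rcases x with s | s <;>
  · by_cases hi : s = i
    · subst hi; assumption
    by_cases hj : s = j
    · subst hj; assumption
    first
    | exact (hrest s hi hj).1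
    | exact (hrest s hi hj).2

/-- `s` is one of the letters which split the pairs of the column `C`. -/
def IsSplitLetter (C : Finset (KNLetter m)) (t : Fin m → Fin m) (s : Fin m) : Prop :=
  ∃ z, pos z ∈ C ∧ bar z ∈ C ∧ t z = s

theorem IsColumnSplitting.notMem_of_isSplitLetter (ht : IsColumnSplitting C t) {s : Fin m}
    (hs : IsSplitLetter C t s) : pos s ∉ C ∧ bar s ∉ C := by
  obtain ⟨z, h1, h2, rfl⟩ := hs
  exact ⟨(ht z h1 h2).1.2.1, (ht z h1 h2).1.2.2.1⟩

theorem IsColumnSplitting.first_not_pair (ht : IsColumnSplitting C t) {i₀ : Fin m}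
    (h₀ : i₀.val = 0) : ¬ (pos i₀ ∈ C ∧ bar i₀ ∈ C) := by
  rintro ⟨h1, h2⟩
  have := (ht i₀ h1 h2).1.1
  rw [Fin.lt_def] at this
  omega

theorem IsColumnSplitting.second_pair (ht : IsColumnSplitting C t) {i₀ i₁ : Fin m}
    (h₀ : i₀.val = 0) (h₁ : i₁.val = 1) (hp : pos i₁ ∈ C) (hb : bar i₁ ∈ C) :
    IsSplitLetter C t i₀ := by
  have := (ht i₁ hp hb).1.1
  rw [Fin.lt_def] at this
  exact ⟨i₁, hp, hb, Fin.ext (by omega)⟩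

theorem split_rest {i j : Fin m}
    (hrest : ∀ s, s ≠ i → s ≠ j → (pos s ∈ C' ↔ pos s ∈ C) ∧ (bar s ∈ C' ↔ bar s ∈ C))
    (hE : ∀ s, s ≠ i → s ≠ j → (IsSplitLetter C' t' s ↔ IsSplitLetter C t s)) :
    (∀ s, s ≠ i → s ≠ j → (pos s ∈ leftColumn C' t' ↔ pos s ∈ leftColumn C t) ∧
      (bar s ∈ leftColumn C' t' ↔ bar s ∈ leftColumn C t)) ∧
    (∀ s, s ≠ i → s ≠ j → (pos s ∈ rightColumn C' t' ↔ pos s ∈ rightColumn C t) ∧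
      (bar s ∈ rightColumn C' t' ↔ bar s ∈ rightColumn C t)) := by
  constructor <;> intro s hi hj <;>
    simp only [pos_mem_leftColumn, bar_mem_leftColumn, pos_mem_rightColumn, bar_mem_rightColumn] <;>
    have h1 := hrest s hi hj <;> have h2 := hE s hi hj <;> unfold IsSplitLetter at h2 <;>
    rw [h1.1, h1.2, h2] <;> simp

theorem isSplitLetter_exchange {x y : Fin m} (ht : IsColumnSplitting C t)
    (hrest : ∀ s, s ≠ x → s ≠ y → (pos s ∈ C' ↔ pos s ∈ C) ∧ (bar s ∈ C' ↔ bar s ∈ C))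
    (hy : pos y ∈ C ∧ bar y ∉ C ∨ pos y ∉ C ∧ bar y ∈ C)
    (hx : pos x ∉ C ∧ bar x ∉ C)
    (hx' : pos x ∈ C' ∧ bar x ∉ C' ∨ pos x ∉ C' ∧ bar x ∈ C')
    (hy' : pos y ∉ C' ∧ bar y ∉ C') :
    (IsSplitLetter C' (fun z => if t z = x then y else t z) y ↔ IsSplitLetter C t x) ∧
    ∀ s, s ≠ x → s ≠ y →
      (IsSplitLetter C' (fun z => if t z = x then y else t z) s ↔ IsSplitLetter C t s) := by
  have hpair : ∀ z, (pos z ∈ C' ∧ bar z ∈ C') ↔ (pos z ∈ C ∧ bar z ∈ C) := by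
    intro z
    by_cases h1 : z = x
    · subst h1; tauto
    by_cases h2 : z = y
    · subst h2; tauto
    rw [(hrest z h1 h2).1, (hrest z h1 h2).2]
  have hne : ∀ z, pos z ∈ C → bar z ∈ C → t z ≠ y := by
    rintro z h1 h2 rfl
    have := ht.notMem_of_isSplitLetter ⟨z, h1, h2, rfl⟩
    tauto
  simp only [IsSplitLetter, ← and_assoc, hpair]
  constructor
  · constructor
    · rintro ⟨z, h1, h2⟩
      refine ⟨z, h1, ?_⟩
      by_contra h
      rw [if_neg h] at h2
      exact hne z h1.1 h1.2 h2
    · rintro ⟨z, h1, h2⟩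
      exact ⟨z, h1, if_pos h2⟩
  · intro s hs1 hs2
    refine exists_congr fun z => and_congr_right fun h1 => ?_
    constructor
    · intro h
      split_ifs at h
      exacts [absurd h.symm hs2, h]
    · rintro rfl
      rw [if_neg hs1]

theorem pos_mem_leftColumn' {s : Fin m} :
    pos s ∈ leftColumn C t ↔ (pos s ∈ C ∧ bar s ∉ C) ∨ IsSplitLetter C t s :=
  pos_mem_leftColumn

theorem bar_mem_rightColumn' {s : Fin m} :
    bar s ∈ rightColumn C t ↔ (bar s ∈ C ∧ pos s ∉ C) ∨ IsSplitLetter C t s :=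
  bar_mem_rightColumn

theorem IsColumnSplitting.not_isSplitLetter (ht : IsColumnSplitting C t) {s : Fin m}
    (h : pos s ∈ C ∨ bar s ∈ C) : ¬ IsSplitLetter C t s := fun hs => by
  have := ht.notMem_of_isSplitLetter hs
  tauto

section Lower

variable {i₀ i₁ : Fin m}

/-- The effect on the split column of replacing `1` by `2` in a column without `2` and `1̄`. -/
theorem IsColumnSplitting.lower_pos (ht : IsColumnSplitting C t)
    (h₀ : i₀.val = 0) (h₁ : i₁.val = 1)
    (hrest : ∀ s, s ≠ i₀ → s ≠ i₁ → (pos s ∈ C' ↔ pos s ∈ C) ∧ (bar s ∈ C' ↔ bar s ∈ C))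
    (c1 : pos i₀ ∈ C) (c2 : pos i₁ ∉ C) (c3 : bar i₀ ∉ C)
    (k1 : pos i₀ ∉ C') (k2 : pos i₁ ∈ C') (k3 : bar i₀ ∉ C') (k4 : bar i₁ ∈ C' ↔ bar i₁ ∈ C) :
    ∃ t', IsColumnSplitting C' t' ∧
      (leftColumn C' t' = leftColumn C t ∨ IsLowered i₀ i₁ (leftColumn C t) (leftColumn C' t')) ∧
      IsLowered i₀ i₁ (rightColumn C t) (rightColumn C' t') := by
  have h01 : i₀ ≠ i₁ := fun h => by rw [h] at h₀; omega
  have hlow : ∀ s : Fin m, s ≠ i₀ → s ≠ i₁ → i₀ < s ∧ i₁ < s := by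
    intro s hs1 hs2
    rw [Ne, Fin.ext_iff] at hs1 hs2
    rw [Fin.lt_def, Fin.lt_def]
    omega
  have e1 := ht.not_isSplitLetter (Or.inl c1)
  by_cases c4 : bar i₁ ∈ C
  · -- lowering creates the pair `2`, `2̄`
    have k4 := k4.2 c4
    have hs := ht.create_pair h₀ h₁ hrest c1 c4 c3 k1 k3
    set t' := fun z => if z = i₁ then i₀ else t z with ht'
    have f1 : IsSplitLetter C' t' i₀ := ⟨i₁, k2, k4, by simp [ht']⟩
    have f2 := hs.not_isSplitLetter (Or.inl k2)
    have e2 := ht.not_isSplitLetter (Or.inr c4)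
    have eE : ∀ s, s ≠ i₀ → s ≠ i₁ → (IsSplitLetter C' t' s ↔ IsSplitLetter C t s) := by
      intro s hs1 hs2
      constructor
      · rintro ⟨z, z1, z2, z3⟩
        simp only [ht'] at z3
        split_ifs at z3 with h
        · exact absurd z3.symm hs1
        · have z4 : z ≠ i₀ := fun hh => k1 (hh ▸ z1)
          exact ⟨z, (hrest z z4 h).1.1 z1, (hrest z z4 h).2.1 z2, z3⟩
      · rintro ⟨z, z1, z2, z3⟩
        have z4 : z ≠ i₀ := fun hh => c3 (hh ▸ z2)
        have z5 : z ≠ i₁ := fun hh => c2 (hh ▸ z1)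
        exact ⟨z, (hrest z z4 z5).1.2 z1, (hrest z z4 z5).2.2 z2, by simp only [ht', if_neg z5, z3]⟩
    obtain ⟨rL, rR⟩ := split_rest hrest eE
    refine ⟨t', hs, Or.inl (letters_ext rL ?_ ?_ ?_ ?_),
      isLowered_of_mem_iff h01 ?_ ?_ rR ?_ ?_ ?_ ?_⟩ <;>
    simp [pos_mem_leftColumn', bar_mem_leftColumn, pos_mem_rightColumn, bar_mem_rightColumn',
      c1, c2, c3, c4, k1, k2, k3, k4, e1, e2, f1, f2]
  · have k4 : bar i₁ ∉ C' := fun h => c4 (k4.1 h)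
    have hs := ht.exchange (C' := C') (x := i₁) (y := i₀) (fun s s1 s2 => (hlow s s2 s1).symm)
      (fun s s1 s2 => hrest s s2 s1) (Or.inl ⟨c1, c3⟩) ⟨c2, c4⟩ (Or.inl ⟨k2, k4⟩) ⟨k1, k3⟩
    obtain ⟨f1, e3⟩ := isSplitLetter_exchange (C' := C') (x := i₁) (y := i₀) ht
      (fun s s1 s2 => hrest s s2 s1) (Or.inl ⟨c1, c3⟩) ⟨c2, c4⟩ (Or.inl ⟨k2, k4⟩) ⟨k1, k3⟩
    set t' := fun z => if t z = i₁ then i₀ else t z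
    have f2 := hs.not_isSplitLetter (Or.inl k2)
    obtain ⟨rL, rR⟩ := split_rest hrest (fun s s1 s2 => e3 s s2 s1)
    by_cases e2 : IsSplitLetter C t i₁
    · refine ⟨t', hs, Or.inl (letters_ext rL ?_ ?_ ?_ ?_),
        isLowered_of_mem_iff h01 ?_ ?_ rR ?_ ?_ ?_ ?_⟩ <;>
      simp [pos_mem_leftColumn', bar_mem_leftColumn, pos_mem_rightColumn, bar_mem_rightColumn',
        c1, c2, c3, c4, k1, k2, k3, k4, e1, e2, f1, f2]
    · refine ⟨t', hs, Or.inr (isLowered_of_mem_iff h01 ?_ ?_ rL ?_ ?_ ?_ ?_),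
        isLowered_of_mem_iff h01 ?_ ?_ rR ?_ ?_ ?_ ?_⟩ <;>
      simp [pos_mem_leftColumn', bar_mem_leftColumn, pos_mem_rightColumn, bar_mem_rightColumn',
        c1, c2, c3, c4, k1, k2, k3, k4, e1, e2, f1, f2]

/-- The effect on the split column of replacing `2̄` by `1̄` in a column without `1` and `1̄`. -/
theorem IsColumnSplitting.lower_bar (ht : IsColumnSplitting C t)
    (h₀ : i₀.val = 0) (h₁ : i₁.val = 1)
    (hrest : ∀ s, s ≠ i₀ → s ≠ i₁ → (pos s ∈ C' ↔ pos s ∈ C) ∧ (bar s ∈ C' ↔ bar s ∈ C))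
    (c1 : pos i₀ ∉ C) (c3 : bar i₀ ∉ C) (c4 : bar i₁ ∈ C)
    (k1 : pos i₀ ∉ C') (k2 : pos i₁ ∈ C' ↔ pos i₁ ∈ C) (k3 : bar i₀ ∈ C') (k4 : bar i₁ ∉ C') :
    ∃ t', IsColumnSplitting C' t' ∧
      IsLowered i₀ i₁ (leftColumn C t) (leftColumn C' t') ∧
      (rightColumn C' t' = rightColumn C t ∨
        IsLowered i₀ i₁ (rightColumn C t) (rightColumn C' t') ∧ pos i₁ ∉ C) := by
  have h01 : i₀ ≠ i₁ := fun h => by rw [h] at h₀; omega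
  have hlow : ∀ s : Fin m, s ≠ i₀ → s ≠ i₁ → i₀ < s ∧ i₁ < s := by
    intro s hs1 hs2
    rw [Ne, Fin.ext_iff] at hs1 hs2
    rw [Fin.lt_def, Fin.lt_def]
    omega
  have e2 := ht.not_isSplitLetter (Or.inr c4)
  by_cases c2 : pos i₁ ∈ C
  · -- lowering destroys the pair `2`, `2̄`
    have k2 := k2.2 c2
    have hs := ht.remove_pair h₀ h₁ hrest c2 c4 k1 k3 k2 k4
    have e1 := ht.second_pair h₀ h₁ c2 c4
    have f1 := hs.not_isSplitLetter (Or.inr k3)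
    have f2 := hs.not_isSplitLetter (Or.inl k2)
    have eE : ∀ s, s ≠ i₀ → s ≠ i₁ → (IsSplitLetter C' t s ↔ IsSplitLetter C t s) := by
      intro s hs1 hs2
      constructor
      · rintro ⟨z, z1, z2, z3⟩
        have z4 : z ≠ i₀ := fun hh => k1 (hh ▸ z1)
        have z5 : z ≠ i₁ := fun hh => k4 (hh ▸ z2)
        exact ⟨z, (hrest z z4 z5).1.1 z1, (hrest z z4 z5).2.1 z2, z3⟩
      · rintro ⟨z, z1, z2, z3⟩
        have z4 : z ≠ i₀ := fun hh => c1 (hh ▸ z1)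
        have z5 : z ≠ i₁ := by
          rintro rfl
          have := (ht z z1 z2).1.1
          rw [z3, Fin.lt_def] at this
          exact hs1 (Fin.ext (by omega))
        exact ⟨z, (hrest z z4 z5).1.2 z1, (hrest z z4 z5).2.2 z2, z3⟩
    obtain ⟨rL, rR⟩ := split_rest hrest eE
    refine ⟨t, hs, isLowered_of_mem_iff h01 ?_ ?_ rL ?_ ?_ ?_ ?_,
      Or.inl (letters_ext rR ?_ ?_ ?_ ?_)⟩ <;>
    simp [pos_mem_leftColumn', bar_mem_leftColumn, pos_mem_rightColumn, bar_mem_rightColumn',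
      c1, c2, c3, c4, k1, k2, k3, k4, e1, e2, f1, f2]
  · have k2 : pos i₁ ∉ C' := fun h => c2 (k2.1 h)
    have hs := ht.exchange (C' := C') (x := i₀) (y := i₁) hlow
      hrest (Or.inr ⟨c2, c4⟩) ⟨c1, c3⟩ (Or.inr ⟨k1, k3⟩) ⟨k2, k4⟩
    obtain ⟨f2, e3⟩ := isSplitLetter_exchange (C' := C') (x := i₀) (y := i₁) ht
      hrest (Or.inr ⟨c2, c4⟩) ⟨c1, c3⟩ (Or.inr ⟨k1, k3⟩) ⟨k2, k4⟩
    set t' := fun z => if t z = i₀ then i₁ else t z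
    have f1 := hs.not_isSplitLetter (Or.inr k3)
    obtain ⟨rL, rR⟩ := split_rest hrest e3
    by_cases e1 : IsSplitLetter C t i₀
    · refine ⟨t', hs, isLowered_of_mem_iff h01 ?_ ?_ rL ?_ ?_ ?_ ?_,
        Or.inl (letters_ext rR ?_ ?_ ?_ ?_)⟩ <;>
      simp [pos_mem_leftColumn', bar_mem_leftColumn, pos_mem_rightColumn, bar_mem_rightColumn',
        c1, c2, c3, c4, k1, k2, k3, k4, e1, e2, f1, f2]
    · refine ⟨t', hs, isLowered_of_mem_iff h01 ?_ ?_ rL ?_ ?_ ?_ ?_,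
        Or.inr ⟨isLowered_of_mem_iff h01 ?_ ?_ rR ?_ ?_ ?_ ?_, c2⟩⟩ <;>
      simp [pos_mem_leftColumn', bar_mem_leftColumn, pos_mem_rightColumn, bar_mem_rightColumn',
        c1, c2, c3, c4, k1, k2, k3, k4, e1, e2, f1, f2]

namespace KNLetter

theorem sign_eq_one_iff {i j : Fin m} (hij : i ≠ j) {x : KNLetter m} :
    sign i j x = 1 ↔ x = pos i ∨ x = bar j := by
  rcases x with s | s
  · by_cases h1 : s = i
    · simp [sign, h1]
    · by_cases h2 : s = j <;> simp [sign, h1, h2, hij.symm]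
  · by_cases h1 : s = j
    · simp [sign, h1]
    · by_cases h2 : s = i <;> simp [sign, h1, h2, hij]

end KNLetter

/-- Lowering a letter `x` of a column, whose sign survives the cancellation inside the column,
lowers all letters of the left column or none, and likewise for the right column. -/
theorem IsColumnSplitting.lower (ht : IsColumnSplitting C t)
    (h₀ : i₀.val = 0) (h₁ : i₁.val = 1) {x : KNLetter m} (hx : x ∈ C) (hsgn : sign i₀ i₁ x = 1)
    (hx₀ : x = pos i₀ → pos i₁ ∉ C) (hx₁ : x = bar i₁ → bar i₀ ∉ C ∧ pos i₀ ∉ C)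
    (hC' : C' = insert (KNLetter.lower i₀ i₁ x) (C.erase x)) :
    ∃ t', IsColumnSplitting C' t' ∧
      (leftColumn C' t' = leftColumn C t ∨ IsLowered i₀ i₁ (leftColumn C t) (leftColumn C' t')) ∧
      (rightColumn C' t' = rightColumn C t ∨
        IsLowered i₀ i₁ (rightColumn C t) (rightColumn C' t') ∧ (x = bar i₁ → pos i₁ ∉ C)) := by
  have h01 : i₀ ≠ i₁ := fun h => by rw [h] at h₀; omega
  have h10 := h01.symm
  have hnp := ht.first_not_pair h₀
  have hmem : ∀ y, y ∈ C' ↔ y = KNLetter.lower i₀ i₁ x ∨ y ≠ x ∧ y ∈ C := by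
    intro y
    rw [hC', Finset.mem_insert, Finset.mem_erase]
  rcases (sign_eq_one_iff h01).1 hsgn with rfl | rfl
  · have c3 : bar i₀ ∉ C := fun h => hnp ⟨hx, h⟩
    obtain ⟨t', h1, h2, h3⟩ := ht.lower_pos (C' := C') h₀ h₁
      (by intro s hs1 hs2; simp [hmem, KNLetter.lower, hs1, hs2]) hx (hx₀ rfl) c3
      (by simp [hmem, KNLetter.lower, h01]) (by simp [hmem, KNLetter.lower])
      (by simp [hmem, KNLetter.lower, c3]) (by simp [hmem, KNLetter.lower])
    exact ⟨t', h1, h2, Or.inr ⟨h3, by simp⟩⟩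
  · obtain ⟨ha', ha⟩ := hx₁ rfl
    obtain ⟨t', h1, h2, h3⟩ := ht.lower_bar (C' := C') h₀ h₁
      (by intro s hs1 hs2; simp [hmem, KNLetter.lower, hs1, hs2]) ha ha' hx
      (by simp [hmem, KNLetter.lower, ha]) (by simp [hmem, KNLetter.lower])
      (by simp [hmem, KNLetter.lower]) (by simp [hmem, KNLetter.lower, h10])
    exact ⟨t', h1, Or.inr h2, h3.imp id fun h => ⟨h.1, fun _ => h.2⟩⟩

end Lower

end Columns

/-! ### Lowering a tableau -/

section Tableaux

open KNLetter

variable {m : ℕ} {i₀ i₁ : Fin m}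

/-- A column that can be split is admissible: the splitting injects the pairs up to `i` into the
free letters up to `i`. -/
theorem IsColumnSplitting.admissibleColumn {C : Finset (KNLetter m)} {t : Fin m → Fin m}
    (ht : IsColumnSplitting C t) : AdmissibleColumn C := by
  classical
  intro i _ _
  set A : Finset (Fin m) := (Finset.Iic i).filter fun s => pos s ∈ C with hA
  set B : Finset (Fin m) := (Finset.Iic i).filter fun s => bar s ∈ C with hB
  have h1 : C.filter (fun x => x ≤ pos i) = A.image pos := by
    ext x
    simp only [hA, Finset.mem_filter, Finset.mem_image, Finset.mem_Iic]
    constructor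
    · rintro ⟨hx, hle⟩
      rcases x with s | s
      · exact ⟨s, ⟨hle, hx⟩, rfl⟩
      · rw [le_iff_rank] at hle
        simp only [rank] at hle
        omega
    · rintro ⟨s, ⟨hs, hx⟩, rfl⟩
      exact ⟨hx, hs⟩
  have h2 : C.filter (fun x => bar i ≤ x) = B.image bar := by
    ext x
    simp only [hB, Finset.mem_filter, Finset.mem_image, Finset.mem_Iic]
    constructor
    · rintro ⟨hx, hle⟩
      rw [le_iff_rank] at hle
      rcases x with s | s
      · simp only [rank] at hle
        omega
      · simp only [rank] at hle
        refine ⟨s, ⟨?_, hx⟩, rfl⟩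
        rw [Fin.le_def]
        omega
    · rintro ⟨s, ⟨hs, hx⟩, rfl⟩
      rw [Fin.le_def] at hs
      refine ⟨hx, ?_⟩
      rw [le_iff_rank]
      simp only [rank]
      omega
  have h3 : (A ∩ B).card ≤ (Finset.Iic i \ (A ∪ B)).card := by
    refine Finset.card_le_card_of_injOn t ?_ ?_
    · intro z hz
      simp only [hA, hB, Finset.coe_inter, Finset.coe_filter, Finset.mem_Iic, Set.mem_inter_iff,
        Set.mem_ofPred_eq] at hz
      have h := (ht z hz.1.2 hz.2.2).1
      simp only [Finset.mem_coe, Finset.mem_sdiff, Finset.mem_Iic, Finset.mem_union, hA, hB,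
        Finset.mem_filter]
      refine ⟨h.1.le.trans hz.1.1, ?_⟩
      rintro (h' | h')
      exacts [h.2.1 h'.2, h.2.2.1 h'.2]
    · intro z hz z' hz' heq
      simp only [hA, hB, Finset.coe_inter, Finset.coe_filter, Set.mem_inter_iff,
        Set.mem_ofPred_eq] at hz hz'
      rcases lt_trichotomy z z' with h | h | h
      · exact absurd heq ((ht z hz.1.2 hz.2.2).1.2.2.2 z' hz'.1.2 hz'.2.2 h).ne
      · exact h
      · exact absurd heq ((ht z' hz'.1.2 hz'.2.2).1.2.2.2 z hz.1.2 hz.2.2 h).ne'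
  have h4 : A ∪ B ⊆ Finset.Iic i := Finset.union_subset (Finset.filter_subset _ _)
    (Finset.filter_subset _ _)
  rw [Finset.card_sdiff_of_subset h4, Fin.card_Iic] at h3
  have h5 := Finset.card_le_card h4
  rw [Fin.card_Iic] at h5
  have h6 := Finset.card_union_add_card_inter A B
  rw [h1, h2, Finset.card_image_of_injective _ (fun _ _ h => by simpa using h),
    Finset.card_image_of_injective _ (fun _ _ h => by simpa using h)]
  omega

namespace KNLetter

theorem sign_neg_iff {x : KNLetter m} (h : sign i₀ i₁ x < 0) : x = pos i₁ ∨ x = bar i₀ := by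
  rcases x with s | s
  · by_cases h1 : s = i₀
    · simp [sign, h1] at h
    · by_cases h2 : s = i₁
      · simp [h2]
      · simp [sign, h1, h2] at h
  · by_cases h1 : s = i₁
    · simp [sign, h1] at h
    · by_cases h2 : s = i₀
      · simp [h2]
      · simp [sign, h1, h2] at h

theorem sign_le_one (x : KNLetter m) : sign i₀ i₁ x ≤ 1 := by
  rcases x with s | s <;> simp only [sign] <;> split_ifs <;> norm_num

theorem lower_cases (h₀ : i₀.val = 0) (h₁ : i₁.val = 1) (x : KNLetter m) :
    lower i₀ i₁ x = x ∨ (x = pos i₀ ∨ x = bar i₁) ∧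
      (lower i₀ i₁ x = pos i₁ ∨ lower i₀ i₁ x = bar i₀) ∧
      rank (lower i₀ i₁ x) = rank x + 1 := by
  rcases x with s | s
  · by_cases h : s = i₀
    · right
      subst h
      simp [lower, rank, h₀, h₁]
    · simp [lower, h]
  · by_cases h : s = i₁
    · right
      subst h
      have := s.isLt
      refine ⟨Or.inr rfl, by simp [lower], ?_⟩
      simp only [lower, rank, h₀, h₁, if_true]
      omega
    · simp [lower, h]

theorem le_lower (h₀ : i₀.val = 0) (h₁ : i₁.val = 1) (x : KNLetter m) : x ≤ lower i₀ i₁ x := by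
  rcases lower_cases h₀ h₁ x with h | ⟨-, -, h⟩
  · exact h.ge
  · rw [le_iff_rank, h]
    omega

theorem lower_le_of_lt (h₀ : i₀.val = 0) (h₁ : i₁.val = 1) {x y : KNLetter m} (h : x < y) :
    lower i₀ i₁ x ≤ y := by
  rcases lower_cases h₀ h₁ x with h' | ⟨-, -, h'⟩
  · exact h'.trans_le h.le
  · rw [le_iff_rank, h']
    exact h

theorem lower_lt_lower (h₀ : i₀.val = 0) (h₁ : i₁.val = 1) {x y : KNLetter m} (h : x < y)
    (hy : y ≠ pos i₁) (hy' : y ≠ bar i₀) : lower i₀ i₁ x < lower i₀ i₁ y := by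
  refine lt_of_lt_of_le (lt_of_le_of_ne (lower_le_of_lt h₀ h₁ h) ?_) (le_lower h₀ h₁ y)
  intro heq
  rcases lower_cases h₀ h₁ x with h' | ⟨-, h' | h', -⟩
  · exact h.ne (h'.symm.trans heq)
  · exact hy (heq.symm.trans h')
  · exact hy' (heq.symm.trans h')

end KNLetter

variable {lam mu : YoungDiagram} {T L R : SkewFilling lam mu m}

theorem mem_columnSet {j : ℕ} {x : KNLetter m} :
    x ∈ columnSet T j ↔ ∃ c : SkewCell lam mu, c.1.2 = j ∧ T c = x := by
  simp [columnSet]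

theorem apply_mem_columnSet (T : SkewFilling lam mu m) {c : SkewCell lam mu} {j : ℕ}
    (hc : c.1.2 = j) : T c ∈ columnSet T j :=
  mem_columnSet.2 ⟨c, hc, rfl⟩

theorem ColumnStrict.lt_iff (hT : ColumnStrict T) {c d : SkewCell lam mu} (h : c.1.2 = d.1.2) :
    T c < T d ↔ c.1.1 < d.1.1 := by
  refine ⟨fun hlt => ?_, hT c d h⟩
  by_contra hle
  rcases (not_lt.1 hle).eq_or_lt with h' | h'
  · have : c = d := Subtype.ext (Prod.ext h'.symm h)
    rw [this] at hlt
    exact hlt.false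
  · exact hlt.asymm (hT d c h.symm h')

theorem ColumnStrict.eq_of_apply_eq (hT : ColumnStrict T) {c d : SkewCell lam mu}
    (h : c.1.2 = d.1.2) (heq : T c = T d) : c = d := by
  refine Subtype.ext (Prod.ext (le_antisymm ?_ ?_) h)
  · exact not_lt.1 fun hlt => (hT d c h.symm hlt).ne' heq
  · exact not_lt.1 fun hlt => (hT c d h hlt).ne heq

theorem ColumnStrict.card_columnSet (hT : ColumnStrict T) (j : ℕ) :
    (columnSet T j).card = (Finset.univ.filter fun c : SkewCell lam mu => c.1.2 = j).card :=
  Finset.card_image_of_injOn fun x hx y hy hxy => by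
    simp only [Finset.coe_filter, Finset.mem_univ, true_and, Set.mem_ofPred_eq] at hx hy
    exact hT.eq_of_apply_eq (hx.trans hy.symm) hxy

theorem ColumnStrict.injOn_of_columnSet_eq_image {A B : SkewFilling lam mu m}
    (hA : ColumnStrict A) (hB : ColumnStrict B) {j : ℕ} (g : KNLetter m → KNLetter m)
    (h : columnSet B j = (columnSet A j).image g) : Set.InjOn g (columnSet A j) := by
  rw [← Finset.card_image_iff, ← h, hA.card_columnSet, hB.card_columnSet]

/-- If the entries of the column of `B` arise from those of `A` by enlarging letters and sorting,
then `B` is at least `A` in every box of the column. -/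
theorem ColumnStrict.le_of_columnSet_eq_image {A B : SkewFilling lam mu m} (hA : ColumnStrict A)
    (hB : ColumnStrict B) {j : ℕ} (g : KNLetter m → KNLetter m)
    (hg : ∀ x ∈ columnSet A j, x ≤ g x) (h : columnSet B j = (columnSet A j).image g)
    {c : SkewCell lam mu} (hc : c.1.2 = j) : A c ≤ B c := by
  classical
  set F : Finset (SkewCell lam mu) := Finset.univ.filter fun c => c.1.2 = j with hF
  have hinj := hA.injOn_of_columnSet_eq_image hB g h
  by_contra hlt
  rw [not_le] at hlt
  -- the entries of `A` from `c` downwards are mapped to entries of `B` strictly below `c`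
  have hex : ∀ e : SkewCell lam mu, ∃ e' : SkewCell lam mu, e.1.2 = j → c.1.1 ≤ e.1.1 →
      e'.1.2 = j ∧ c.1.1 < e'.1.1 ∧ B e' = g (A e) := by
    intro e
    by_cases he : e.1.2 = j ∧ c.1.1 ≤ e.1.1
    · have h1 : g (A e) ∈ columnSet B j := by
        rw [h]
        exact Finset.mem_image_of_mem _ (apply_mem_columnSet A he.1)
      obtain ⟨e', he', h2⟩ := mem_columnSet.1 h1
      refine ⟨e', fun _ _ => ⟨he', ?_, h2⟩⟩
      rw [← hB.lt_iff (hc.trans he'.symm), h2]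
      refine hlt.trans_le (le_trans ?_ (hg _ (apply_mem_columnSet A he.1)))
      rw [← not_lt, hA.lt_iff (he.1.trans hc.symm)]
      exact not_lt.2 he.2
    · exact ⟨e, fun h1 h2 => absurd ⟨h1, h2⟩ he⟩
  choose f hf using hex
  have hle : (F.filter fun e => c.1.1 ≤ e.1.1).card ≤ (F.filter fun e => c.1.1 < e.1.1).card := by
    refine Finset.card_le_card_of_injOn f ?_ ?_
    · intro e he
      simp only [hF, Finset.coe_filter, Finset.mem_filter, Finset.mem_univ, true_and,
        Set.mem_ofPred_eq] at he ⊢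
      obtain ⟨h1, h2, -⟩ := hf e he.1 he.2
      exact ⟨h1, h2⟩
    · intro e he e' he' heq
      simp only [hF, Finset.coe_filter, Finset.mem_filter, Finset.mem_univ, true_and,
        Set.mem_ofPred_eq] at he he'
      obtain ⟨-, -, h3⟩ := hf e he.1 he.2
      obtain ⟨-, -, h3'⟩ := hf e' he'.1 he'.2
      rw [heq, h3'] at h3
      exact (hA.eq_of_apply_eq (he'.1.trans he.1.symm)
        (hinj (apply_mem_columnSet A he'.1) (apply_mem_columnSet A he.1) h3)).symm
  refine absurd hle (not_le.2 (Finset.card_lt_card ⟨?_, fun hsub => ?_⟩))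
  · intro e he
    rw [Finset.mem_filter] at he ⊢
    exact ⟨he.1, he.2.le⟩
  · have : c ∈ F.filter fun e => c.1.1 < e.1.1 := hsub (by simp [hF, hc])
    simp at this

theorem ColumnStrict.ge_of_columnSet_eq_image {A B : SkewFilling lam mu m} (hA : ColumnStrict A)
    (hB : ColumnStrict B) {j : ℕ} (g : KNLetter m → KNLetter m)
    (hg : ∀ x ∈ columnSet A j, g x ≤ x) (h : columnSet B j = (columnSet A j).image g)
    {c : SkewCell lam mu} (hc : c.1.2 = j) : B c ≤ A c := by
  classical
  have : Nonempty (KNLetter m) := ⟨A c⟩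
  have hinv := (hA.injOn_of_columnSet_eq_image hB g h).leftInvOn_invFunOn
  refine hB.le_of_columnSet_eq_image hA (Function.invFunOn g (columnSet A j)) ?_ ?_ hc
  · intro y hy
    rw [h, Finset.mem_image] at hy
    obtain ⟨x, hx, rfl⟩ := hy
    rw [hinv hx]
    exact hg x hx
  · rw [h, Finset.image_image]
    refine Eq.symm ((Finset.image_congr fun x hx => hinv hx).trans Finset.image_id)

theorem ColumnStrict.left_le (hT : ColumnStrict T) (hL : ColumnStrict L) {j : ℕ}
    {t : Fin m → Fin m} (ht : IsColumnSplitting (columnSet T j) t)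
    (h : columnSet L j = leftColumn (columnSet T j) t) {c : SkewCell lam mu} (hc : c.1.2 = j) :
    L c ≤ T c := by
  refine hT.ge_of_columnSet_eq_image hL _ ?_ h hc
  rintro (z | z) hz
  · dsimp only
    split_ifs with h'
    · exact (ht z hz h').1.1.le
    · exact le_rfl
  · exact le_rfl

theorem ColumnStrict.le_right (hT : ColumnStrict T) (hR : ColumnStrict R) {j : ℕ}
    {t : Fin m → Fin m} (ht : IsColumnSplitting (columnSet T j) t)
    (h : columnSet R j = rightColumn (columnSet T j) t) {c : SkewCell lam mu} (hc : c.1.2 = j) :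
    T c ≤ R c := by
  refine hT.le_of_columnSet_eq_image hR _ ?_ h hc
  rintro (z | z) hz
  · exact le_rfl
  · dsimp only
    split_ifs with h'
    · have := (ht z h' hz).1.1
      rw [Fin.lt_def] at this
      rw [le_iff_rank]
      simp only [rank]
      omega
    · exact le_rfl

end Tableaux

section Closure

open KNLetter

variable {m : ℕ} {i₀ i₁ : Fin m} {lam mu : YoungDiagram} {T L R : SkewFilling lam mu m}

/-- The reading order of the boxes: columns from right to left, each from top to bottom. -/
def readingKey (c : SkewCell lam mu) : ℕᵒᵈ ×ₗ ℕ :=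
  toLex (OrderDual.toDual c.1.2, c.1.1)

theorem readingKey_le_iff {c d : SkewCell lam mu} :
    readingKey c ≤ readingKey d ↔ d.1.2 < c.1.2 ∨ c.1.2 = d.1.2 ∧ c.1.1 ≤ d.1.1 := by
  simp [readingKey, Prod.Lex.toLex_le_toLex]

theorem readingKey_lt_iff {c d : SkewCell lam mu} :
    readingKey c < readingKey d ↔ d.1.2 < c.1.2 ∨ c.1.2 = d.1.2 ∧ c.1.1 < d.1.1 := by
  simp [readingKey, Prod.Lex.toLex_lt_toLex]

theorem readingKey_injective : Function.Injective (readingKey (lam := lam) (mu := mu)) := by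
  intro c d h
  have h1 := readingKey_le_iff.1 h.le
  have h2 := readingKey_le_iff.1 h.ge
  exact Subtype.ext (Prod.ext (by omega) (by omega))

/-- A skew shape contains every box that lies weakly south-east of one of its boxes and weakly
north-west of another. -/
theorem skewCell_mem {c d : SkewCell lam mu} {i j : ℕ} (h1 : c.1.1 ≤ i) (h2 : c.1.2 ≤ j)
    (h3 : i ≤ d.1.1) (h4 : j ≤ d.1.2) : (i, j) ∈ lam.cells \ mu.cells := by
  have hc := c.2
  have hd := d.2
  rw [Finset.mem_sdiff, YoungDiagram.mem_cells, YoungDiagram.mem_cells] at hc hd ⊢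
  exact ⟨lam.up_left_mem h3 h4 hd.1, fun h => hc.2 (mu.up_left_mem h1 h2 h)⟩

/-- A plus sign would be cancelled by a minus sign on the next letter of the same column. -/
theorem IsFirstUnmatched.notMem_next (hT : ColumnStrict T) {p : SkewCell lam mu}
    (hp : IsFirstUnmatched readingKey (sign i₀ i₁ ∘ T) p) {y : KNLetter m}
    (hy : rank y = rank (T p) + 1) (hsgn : sign i₀ i₁ y = -1) : y ∉ columnSet T p.1.2 := by
  classical
  intro hmem
  obtain ⟨d, hd, rfl⟩ := mem_columnSet.1 hmem
  have hlt : T p < T d := by rw [lt_iff_rank]; omega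
  have hrow := (hT.lt_iff hd.symm).1 hlt
  have hne : p ≠ d := by rintro rfl; exact hlt.false
  have h := hp.sum_pos {p, d} (by simp) (by
    intro c hc
    rw [Finset.mem_insert, Finset.mem_singleton] at hc
    rcases hc with rfl | rfl
    · exact le_rfl
    · exact readingKey_le_iff.2 (Or.inr ⟨hd.symm, hrow.le⟩)) (by
    intro c hc e h1 h2
    have h3 : readingKey c ≤ readingKey d := by
      rw [Finset.mem_insert, Finset.mem_singleton] at hc
      rcases hc with rfl | rfl
      · exact readingKey_le_iff.2 (Or.inr ⟨hd.symm, hrow.le⟩)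
      · exact le_rfl
    have h4 := readingKey_le_iff.1 (h2.trans h3)
    rw [readingKey_le_iff] at h1
    have h5 : e.1.2 = p.1.2 := by omega
    rw [Finset.mem_insert, Finset.mem_singleton]
    by_contra hnot
    rw [not_or] at hnot
    have h6 : T p < T e := (hT.lt_iff h5.symm).2 (lt_of_le_of_ne (by omega) fun h =>
      hnot.1 (Subtype.ext (Prod.ext h.symm h5)))
    have h7 : T e < T d := (hT.lt_iff (h5.trans hd.symm)).2 (lt_of_le_of_ne (by omega) fun h =>
      hnot.2 (Subtype.ext (Prod.ext h (h5.trans hd.symm))))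
    rw [lt_iff_rank] at h6 h7
    omega)
  rw [Finset.sum_pair hne, Function.comp_apply, Function.comp_apply, hsgn] at h
  have := sign_le_one (i₀ := i₀) (i₁ := i₁) (T p)
  omega

/-- A segment of the reading word which ends just before the first surviving plus sign and
contains a plus sign contains a minus sign. -/
theorem IsFirstUnmatched.exists_neg {p d : SkewCell lam mu}
    (hp : IsFirstUnmatched readingKey (sign i₀ i₁ ∘ T) p) (hd : readingKey d < readingKey p)
    (hsgn : 0 < sign i₀ i₁ (T d)) :
    ∃ c, readingKey d ≤ readingKey c ∧ readingKey c < readingKey p ∧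
      (T c = pos i₁ ∨ T c = bar i₀) := by
  classical
  by_contra hno
  have h := hp.sum_nonpos
    (Finset.univ.filter fun c => readingKey d ≤ readingKey c ∧ readingKey c < readingKey p)
    (by simp) (by
      intro c hc e h1 h2
      simp only [Finset.mem_filter, Finset.mem_univ, true_and] at hc ⊢
      exact ⟨hc.1.trans h1, h2⟩)
  refine absurd h (not_le.2 (Finset.sum_pos' ?_ ⟨d, by simp [hd], hsgn⟩))
  intro c hc
  simp only [Finset.mem_filter, Finset.mem_univ, true_and] at hc
  by_contra hneg
  exact hno ⟨c, hc.1, hc.2, sign_neg_iff (not_le.1 hneg)⟩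

theorem IsFirstUnmatched.pos_notMem (hT : ColumnStrict T) {p : SkewCell lam mu}
    (hp : IsFirstUnmatched readingKey (sign i₀ i₁ ∘ T) p) (h₀ : i₀.val = 0) (h₁ : i₁.val = 1)
    {t : Fin m → Fin m} (ht : IsColumnSplitting (columnSet T p.1.2) t) (hTp : T p = bar i₁) :
    pos i₀ ∉ columnSet T p.1.2 := by
  intro hmem
  have hmem' := hmem
  have hm := i₁.isLt
  obtain ⟨d, hd, hTd⟩ := mem_columnSet.1 hmem
  have hrow : d.1.1 < p.1.1 := by
    rw [← hT.lt_iff hd, hTp, hTd, lt_iff_rank]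
    simp only [rank]
    omega
  obtain ⟨c, h1, h2, h3⟩ := hp.exists_neg (d := d) (readingKey_lt_iff.2 (Or.inr ⟨hd, hrow⟩))
    (by simp [hTd, sign])
  rw [readingKey_le_iff] at h1
  rw [readingKey_lt_iff] at h2
  have hc : c.1.2 = p.1.2 := by omega
  rcases h3 with h3 | h3
  · exact ht.not_isSplitLetter (Or.inl hmem') (ht.second_pair h₀ h₁
      (h3 ▸ apply_mem_columnSet T hc) (hTp ▸ apply_mem_columnSet T rfl))
  · have : T c < T p := (hT.lt_iff hc).2 (by omega)
    rw [hTp, h3, lt_iff_rank] at this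
    simp only [rank] at this
    omega

/-- In the column to the right of the first surviving plus sign, if no minus sign precedes it in its
own column, each plus sign is cancelled inside the column by the next letter. -/
theorem IsFirstUnmatched.next_column (hT : ColumnStrict T) {p : SkewCell lam mu}
    (hp : IsFirstUnmatched readingKey (sign i₀ i₁ ∘ T) p) (h₀ : i₀.val = 0) (h₁ : i₁.val = 1)
    (hTp : T p = pos i₀ ∨ T p = bar i₁) (hTp' : T p = bar i₁ → pos i₁ ∉ columnSet T p.1.2)
    {t : Fin m → Fin m} (ht : IsColumnSplitting (columnSet T (p.1.2 + 1)) t) :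
    (pos i₀ ∈ columnSet T (p.1.2 + 1) → pos i₁ ∈ columnSet T (p.1.2 + 1)) ∧
      (bar i₁ ∈ columnSet T (p.1.2 + 1) → bar i₀ ∈ columnSet T (p.1.2 + 1)) := by
  have hm := i₁.isLt
  have key : ∀ d : SkewCell lam mu, d.1.2 = p.1.2 + 1 → 0 < sign i₀ i₁ (T d) →
      ∃ c : SkewCell lam mu, c.1.2 = p.1.2 + 1 ∧ d.1.1 ≤ c.1.1 ∧
        (T c = pos i₁ ∨ T c = bar i₀) := by
    intro d hd hsgn
    obtain ⟨c, h1, h2, h3⟩ := hp.exists_neg (d := d) (readingKey_lt_iff.2 (by omega)) hsgn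
    rw [readingKey_le_iff] at h1
    rw [readingKey_lt_iff] at h2
    by_cases hc : c.1.2 = p.1.2
    · have hlt : T c < T p := (hT.lt_iff hc).2 (by omega)
      exfalso
      rcases hTp with h | h
      · rw [h, lt_iff_rank] at hlt
        simp only [rank] at hlt
        omega
      · rcases h3 with h3 | h3
        · exact hTp' h (h3 ▸ apply_mem_columnSet T hc)
        · rw [h, h3, lt_iff_rank] at hlt
          simp only [rank] at hlt
          omega
    · exact ⟨c, by omega, by omega, h3⟩
  constructor
  · intro hmem
    obtain ⟨d, hd, hTd⟩ := mem_columnSet.1 hmem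
    obtain ⟨c, h1, -, h3 | h3⟩ := key d hd (by simp [hTd, sign])
    · exact h3 ▸ apply_mem_columnSet T h1
    · exact absurd ⟨hmem, h3 ▸ apply_mem_columnSet T h1⟩ (ht.first_not_pair h₀)
  · intro hmem
    obtain ⟨d, hd, hTd⟩ := mem_columnSet.1 hmem
    obtain ⟨c, h1, h2, h3 | h3⟩ := key d hd (by simp [hTd, sign])
    · have : ¬ T c < T d := by
        rw [hT.lt_iff (h1.trans hd.symm)]
        omega
      rw [hTd, h3, lt_iff_rank] at this
      simp only [rank] at this
      omega
    · exact h3 ▸ apply_mem_columnSet T h1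

/-- If each of `1` and `2̄` is followed by `2` and `1̄` in the column `C`, then also in its left
column. -/
theorem IsColumnSplitting.leftColumn_next {C : Finset (KNLetter m)} {t : Fin m → Fin m}
    (ht : IsColumnSplitting C t) (h₀ : i₀.val = 0) (h₁ : i₁.val = 1)
    (h : pos i₀ ∈ C → pos i₁ ∈ C) (h' : bar i₁ ∈ C → bar i₀ ∈ C) :
    (pos i₀ ∈ leftColumn C t → pos i₁ ∈ leftColumn C t) ∧
      (bar i₁ ∈ leftColumn C t → bar i₀ ∈ leftColumn C t) := by
  have hnp := ht.first_not_pair h₀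
  simp only [pos_mem_leftColumn', bar_mem_leftColumn]
  refine ⟨?_, h'⟩
  rintro (⟨h1, h2⟩ | hE)
  · exact Or.inl ⟨h h1, fun hh => h2 (h' hh)⟩
  · obtain ⟨h1, h2⟩ := ht.notMem_of_isSplitLetter hE
    have hb : bar i₁ ∉ C := fun hh => h2 (h' hh)
    by_cases hp : pos i₁ ∈ C
    · exact Or.inl ⟨hp, hb⟩
    · right
      obtain ⟨z, hz1, hz2, hz3⟩ := hE
      by_contra hno
      have hlt : i₁ < z := by
        have h3 : z ≠ i₁ := by rintro rfl; exact hp hz1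
        have h4 : z ≠ i₀ := by rintro rfl; exact h1 hz1
        rw [Ne, Fin.ext_iff] at h3 h4
        rw [Fin.lt_def]
        omega
      -- `2` is free and would be preferred to `1` as the letter splitting the pair at `z`
      have := (ht z hz1 hz2).2 ⟨hlt, hp, hb, fun z' hz1' hz2' hlt' => by
        have h5 := (ht z hz1 hz2).1.2.2.2 z' hz1' hz2' hlt'
        have h6 : t z' ≠ i₁ := fun hh => hno ⟨z', hz1', hz2', hh⟩
        rw [Ne, Fin.ext_iff] at h6
        rw [hz3, Fin.lt_def] at h5
        rw [Fin.lt_def]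
        omega⟩
      rw [hz3, Fin.le_def] at this
      omega

/-- Lowering a column keeps the rows weakly increasing if in the column on its right each letter `1`
and `2̄` is followed by `2` and `1̄`. -/
theorem lower_le_of_next (h₀ : i₀.val = 0) (h₁ : i₁.val = 1) (hL : ColumnStrict L)
    (hR : ColumnStrict R) (hRL : ∀ c d : SkewCell lam mu, c.1.1 = d.1.1 → c.1.2 < d.1.2 → R c ≤ L d)
    {c d : SkewCell lam mu} (hrow : c.1.1 = d.1.1) (hcol : c.1.2 < d.1.2)
    (h1 : pos i₁ ∉ columnSet R c.1.2) (h2 : bar i₀ ∉ columnSet R c.1.2)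
    (h3 : pos i₀ ∈ columnSet L d.1.2 → pos i₁ ∈ columnSet L d.1.2)
    (h4 : bar i₁ ∈ columnSet L d.1.2 → bar i₀ ∈ columnSet L d.1.2) :
    lower i₀ i₁ (R c) ≤ L d := by
  have hle := hRL c d hrow hcol
  rcases hle.lt_or_eq with hlt | heq
  · exact lower_le_of_lt h₀ h₁ hlt
  have key : ∀ x y : KNLetter m, R c = x → rank y = rank x + 1 → y ∉ columnSet R c.1.2 →
      (x ∈ columnSet L d.1.2 → y ∈ columnSet L d.1.2) → False := by
    intro x y hx hxy hy hnext
    obtain ⟨e, he, hLe⟩ := mem_columnSet.1 (hnext (hx ▸ heq ▸ apply_mem_columnSet L rfl))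
    have hde : d.1.1 < e.1.1 := by
      rw [← hL.lt_iff he.symm, hLe, ← heq, hx, lt_iff_rank]
      omega
    let f : SkewCell lam mu := ⟨(e.1.1, c.1.2),
      skewCell_mem (c := c) (d := e) (by omega) le_rfl le_rfl (by omega)⟩
    have hf1 : R c < R f := hR c f rfl (show c.1.1 < e.1.1 by omega)
    have hf2 : R f ≤ L e := hRL f e rfl (show c.1.2 < e.1.2 by omega)
    have : R f = y := by
      apply rank_injective
      rw [hLe, le_iff_rank] at hf2
      rw [hx, lt_iff_rank] at hf1
      omega
    exact hy (this ▸ apply_mem_columnSet R rfl)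
  rcases lower_cases h₀ h₁ (R c) with h | ⟨hx | hx, -, hr⟩
  · rw [h]
    exact hle
  · rw [hx] at hr
    exact (key _ (pos i₁) hx (by simpa [lower] using hr) h1 h3).elim
  · rw [hx] at hr
    exact (key _ (bar i₀) hx (by simpa [lower] using hr) h2 h4).elim

/-- The filling of the split form after the column `j` has been replaced by a lowered one. -/
theorem exists_lowered_filling (h₀ : i₀.val = 0) (h₁ : i₁.val = 1) (hL : ColumnStrict L) (j : ℕ)
    {X : Finset (KNLetter m)} (hX : X = columnSet L j ∨ IsLowered i₀ i₁ (columnSet L j) X) :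
    ∃ L' : SkewFilling lam mu m, ColumnStrict L' ∧ columnSet L' j = X ∧
      (∀ j', j' ≠ j → columnSet L' j' = columnSet L j') ∧ (∀ c, L c ≤ L' c) ∧
      (∀ c, c.1.2 ≠ j → L' c = L c) ∧
      (X = columnSet L j → L' = L) ∧
        (X ≠ columnSet L j → ∀ c, c.1.2 = j → L' c = lower i₀ i₁ (L c)) := by
  classical
  by_cases hX' : X = columnSet L j
  · exact ⟨L, hL, hX'.symm, fun _ _ => rfl, fun _ => le_rfl, fun _ _ => rfl,
      fun _ => rfl, fun h => absurd hX' h⟩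
  · obtain ⟨hX, h1, h2⟩ := hX.resolve_left hX'
    refine ⟨fun c => if c.1.2 = j then lower i₀ i₁ (L c) else L c, ?_, ?_, ?_, ?_, ?_,
      fun h => absurd h hX', ?_⟩
    · intro c d hcol hrow
      have hlt := hL c d hcol hrow
      dsimp only
      rw [hcol]
      split_ifs with h
      · refine lower_lt_lower h₀ h₁ hlt ?_ ?_ <;> intro hh
        · exact h1 (hh ▸ apply_mem_columnSet L h)
        · exact h2 (hh ▸ apply_mem_columnSet L h)
      · exact hlt
    · rw [hX, columnSet, columnSet, Finset.image_image]
      exact Finset.image_congr fun c hc => if_pos (by simpa using hc)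
    · intro j' hj'
      refine Finset.image_congr fun c hc => if_neg ?_
      have : c.1.2 = j' := by simpa using hc
      rw [this]
      exact hj'
    · intro c
      dsimp only
      split_ifs
      exacts [le_lower h₀ h₁ _, le_rfl]
    · intro c hc
      exact if_neg hc
    · intro _ c hc
      exact if_pos hc

/-- Lowering the letter with the first surviving plus sign preserves Kashiwara–Nakashima tableaux.
-/
theorem IsKNSkewTableau.update_lower (hT : IsKNSkewTableau T) (h₀ : i₀.val = 0) (h₁ : i₁.val = 1)
    {p : SkewCell lam mu} (hp : IsFirstUnmatched readingKey (sign i₀ i₁ ∘ T) p) :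
    IsKNSkewTableau (Function.update T p (lower i₀ i₁ (T p))) := by
  classical
  obtain ⟨L, R, hsplit, hLR, hRL⟩ := hT.split
  have hTs := hT.column_strict
  have hm := i₁.isLt
  have h01 : i₀ ≠ i₁ := fun h => by rw [h] at h₀; omega
  have hsgn : sign i₀ i₁ (T p) = 1 :=
    le_antisymm (sign_le_one _) (hp.apply_pos readingKey_injective)
  have hTp := (sign_eq_one_iff h01).1 hsgn
  choose t ht hcL hcR using hsplit.columns
  set j := p.1.2 with hj
  set T' := Function.update T p (lower i₀ i₁ (T p)) with hT'
  have hnext : rank (lower i₀ i₁ (T p)) = rank (T p) + 1 := by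
    rcases lower_cases h₀ h₁ (T p) with h | h
    · rcases hTp with h' | h' <;> rw [h'] at h <;> simp [lower, h01, h01.symm] at h
    · exact h.2.2
  have hnextmem : lower i₀ i₁ (T p) ∉ columnSet T j :=
    hp.notMem_next hTs hnext (by rcases hTp with h | h <;> simp [h, lower, sign, h01, h01.symm])
  have hT's : ColumnStrict T' := by
    intro c d hcol hrow
    have hlt := hTs c d hcol hrow
    by_cases hc : c = p
    · subst hc
      have hd : d ≠ c := by rintro rfl; exact hrow.false
      rw [hT', Function.update_self, Function.update_of_ne hd]
      refine lt_of_le_of_ne (lower_le_of_lt h₀ h₁ hlt) ?_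
      intro heq
      exact hnextmem (heq ▸ apply_mem_columnSet T hcol.symm)
    · rw [hT', Function.update_of_ne hc]
      by_cases hd : d = p
      · subst hd
        rw [Function.update_self]
        exact hlt.trans_le (le_lower h₀ h₁ _)
      · rwa [Function.update_of_ne hd]
  have hC' : columnSet T' j = insert (lower i₀ i₁ (T p)) ((columnSet T j).erase (T p)) := by
    ext y
    rw [Finset.mem_insert, Finset.mem_erase, mem_columnSet, mem_columnSet]
    constructor
    · rintro ⟨c, hc, rfl⟩
      by_cases hcp : c = p
      · subst hcp
        simp [hT']
      · rw [hT', Function.update_of_ne hcp]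
        exact Or.inr ⟨fun h => hcp (hTs.eq_of_apply_eq hc h), c, hc, rfl⟩
    · rintro (rfl | ⟨hy, c, hc, rfl⟩)
      · exact ⟨p, rfl, by simp [hT']⟩
      · exact ⟨c, hc, by rw [hT', Function.update_of_ne (by rintro rfl; exact hy rfl)]⟩
  have hC'' : ∀ j', j' ≠ j → columnSet T' j' = columnSet T j' := by
    intro j' hj'
    refine Finset.image_congr fun c hc => Function.update_of_ne ?_ _ _
    rintro rfl
    exact hj' (Eq.symm (by simpa using hc))
  obtain ⟨t', ht', hL', hR'⟩ := (ht j).lower (C' := columnSet T' j) h₀ h₁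
    (apply_mem_columnSet T rfl) hsgn
    (fun h => by simpa [h, lower] using hnextmem)
    (fun h => ⟨by simpa [h, lower] using hnextmem, hp.pos_notMem hTs h₀ h₁ (ht j) h⟩) hC'
  rw [← hcL] at hL'
  rw [← hcR] at hR'
  obtain ⟨L', sL, cL, cL', leL, -, -, -⟩ := exists_lowered_filling h₀ h₁ hsplit.left_strict j hL'
  obtain ⟨R', sR, cR, cR', leR, eqR, idR, lowR⟩ :=
    exists_lowered_filling h₀ h₁ hsplit.right_strict j
    (hR'.imp id And.left)
  have hcols : ∀ j', ∃ u : Fin m → Fin m, IsColumnSplitting (columnSet T' j') u ∧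
      columnSet L' j' = leftColumn (columnSet T' j') u ∧
      columnSet R' j' = rightColumn (columnSet T' j') u := by
    intro j'
    by_cases h : j' = j
    · subst h
      exact ⟨t', ht', cL, cR⟩
    · rw [hC'' j' h, cL' j' h, cR' j' h]
      exact ⟨t j', ht j', hcL j', hcR j'⟩
  have hLT : ∀ c, L' c ≤ T' c := fun c => by
    obtain ⟨u, h1, h2, -⟩ := hcols c.1.2
    exact hT's.left_le sL h1 h2 rfl
  have hTR : ∀ c, T' c ≤ R' c := fun c => by
    obtain ⟨u, h1, -, h2⟩ := hcols c.1.2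
    exact hT's.le_right sR h1 h2 rfl
  have hRL' : ∀ c d : SkewCell lam mu, c.1.1 = d.1.1 → c.1.2 < d.1.2 → R' c ≤ L' d := by
    intro c d hrow hcol
    refine le_trans ?_ (leL d)
    by_cases hc : c.1.2 = j
    · by_cases hX : rightColumn (columnSet T' j) t' = columnSet R j
      · rw [idR hX]
        exact hRL c d hrow hcol
      · rw [lowR hX c hc]
        obtain ⟨⟨-, h1, h2⟩, h3⟩ := hR'.resolve_left hX
        obtain ⟨h4, h5⟩ := hp.next_column hTs h₀ h₁ hTp h3 (ht (j + 1))
        obtain ⟨h6, h7⟩ := (ht (j + 1)).leftColumn_next h₀ h₁ h4 h5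
        rw [← hcL] at h6 h7
        let e : SkewCell lam mu := ⟨(c.1.1, j + 1),
          skewCell_mem (c := c) (d := d) le_rfl (by omega) hrow.le (by omega)⟩
        have h8 : lower i₀ i₁ (R c) ≤ L e :=
          lower_le_of_next h₀ h₁ hsplit.left_strict hsplit.right_strict hRL rfl
            (show c.1.2 < j + 1 by omega) (hc ▸ h1) (hc ▸ h2) h6 h7
        by_cases hd : d.1.2 = j + 1
        · have : e = d := Subtype.ext (Prod.ext hrow hd.symm)
          rwa [this] at h8
        · exact h8.trans ((hLR e).trans (hRL e d hrow (show j + 1 < d.1.2 by omega)))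
    · rw [eqR c hc]
      exact hRL c d hrow hcol
  exact ⟨fun c d h1 h2 => (hTR c).trans ((hRL' c d h1 h2).trans (hLT d)), hT's,
    fun j' => (hcols j').choose_spec.1.admissibleColumn,
    L', R', ⟨sL, sR, hcols⟩, fun c => (hLT c).trans (hTR c), hRL'⟩

end Closure

/-! ### The symmetry of the weights -/

section Weights

open KNLetter

variable {m : ℕ} {i₀ i₁ : Fin m} {lam mu : YoungDiagram}

/-- The weight of a letter. -/
def KNLetter.weight : KNLetter m → Fin m → ℤ
  | pos i => Pi.single i 1
  | bar i => -Pi.single i 1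

namespace SP

theorem count_eq_sum (T : SP lam mu m) (x : KNLetter m) :
    (T.count x : ℤ) = ∑ c, if T.1 c = x then 1 else 0 := by
  simp [count]

theorem wt_eq_sum (T : SP lam mu m) : T.wt = ∑ c, weight (T.1 c) := by
  funext i
  rw [wt, count_eq_sum, count_eq_sum, ← Finset.sum_sub_distrib, Finset.sum_apply]
  refine Finset.sum_congr rfl fun c _ => ?_
  rcases T.1 c with s | s <;> by_cases h : s = i
  · subst h; simp [weight]
  · simp [weight, h, Ne.symm h]
  · subst h; simp [weight]
  · simp [weight, h, Ne.symm h]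

/-- The filling underlying a tableau. -/
def toFilling (T : SP lam mu m) : SkewFilling lam mu m := T.1

theorem toFilling_injective : Function.Injective (toFilling (lam := lam) (mu := mu) (m := m)) :=
  fun _ _ h => Subtype.ext h

/-- The multiset of the weights of all tableaux. -/
noncomputable def weights (lam mu : YoungDiagram) (m : ℕ) : Multiset (Fin m → ℤ) :=
  (Finset.univ : Finset (SP lam mu m)).val.map wt

theorem count_weights (χ : Fin m → ℤ) :
    (weights lam mu m).count χ =
      {T ∈ {T : SkewFilling lam mu m | IsKNSkewTableau T} | ∑ c, weight (T c) = χ}.ncard := by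
  classical
  have h : {T ∈ {T : SkewFilling lam mu m | IsKNSkewTableau T} | ∑ c, weight (T c) = χ} =
      toFilling '' ((Finset.univ.filter fun T : SP lam mu m => χ = T.wt :
        Finset _) : Set (SP lam mu m)) := by
    ext T
    simp only [Finset.coe_filter, Finset.mem_univ, true_and, wt_eq_sum]
    constructor
    · rintro ⟨h1, h2⟩
      exact ⟨⟨T, h1⟩, h2.symm, rfl⟩
    · rintro ⟨T, h, rfl⟩
      exact ⟨T.2, h.symm⟩
  rw [h, Set.ncard_image_of_injective _ toFilling_injective, Set.ncard_coe_finset, weights,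
    Multiset.count_map]
  rfl

theorem count_weights_le_swap (h₀ : i₀.val = 0) (h₁ : i₁.val = 1) {χ : Fin m → ℤ}
    (hχ : χ i₁ ≤ χ i₀) :
    (weights lam mu m).count χ ≤ (weights lam mu m).count (χ ∘ Equiv.swap i₀ i₁) := by
  classical
  have h01 : i₀ ≠ i₁ := fun h => by rw [h] at h₀; omega
  obtain ⟨k, hk⟩ := Int.eq_ofNat_of_zero_le (sub_nonneg.2 hχ)
  have hsign : ∀ x : KNLetter m, sign i₀ i₁ x = weight x i₀ - weight x i₁ := by
    rintro (s | s)
    · by_cases h : s = i₀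
      · subst h; simp [sign, weight, h01]
      · by_cases h' : s = i₁
        · subst h'; simp [sign, weight, h, h01]
        · simp [sign, weight, h, h', Ne.symm h, Ne.symm h']
    · by_cases h : s = i₀
      · subst h; simp [sign, weight, h01]
      · by_cases h' : s = i₁
        · subst h'; simp [sign, weight, h01]
        · simp [sign, weight, h, h', Ne.symm h, Ne.symm h']
  have hχ' : χ ∘ Equiv.swap i₀ i₁ = χ - k • (Pi.single i₀ 1 - Pi.single i₁ 1) := by
    funext s
    by_cases h : s = i₀
    · subst h
      simp [h01]
      omega
    by_cases h' : s = i₁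
    · subst h'
      simp [h01.symm]
      omega
    simp [Equiv.swap_apply_of_ne_of_ne h h', h, h']
  rw [count_weights, count_weights, hχ']
  refine le_trans (Set.ncard_le_ncard ?_ (Set.toFinite _))
    (ncard_weight_le readingKey_injective (sign i₀ i₁) (lower i₀ i₁) weight
      (Pi.single i₀ 1 - Pi.single i₁ 1) sign_le_one ?_ ?_ ?_ _ ?_ k χ)
  · rintro T ⟨hT, hTχ⟩
    refine ⟨hT, hTχ, Finset.univ, fun _ _ _ _ => Finset.mem_univ _, ?_⟩
    simp only [Function.comp_apply, hsign, Finset.sum_sub_distrib]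
    rw [← hk, ← hTχ, Finset.sum_apply, Finset.sum_apply]
  · intro x hx
    rcases (sign_eq_one_iff h01).1 hx with rfl | rfl <;> simp [lower, sign, h01, h01.symm]
  · intro x hx y hy hxy
    rcases (sign_eq_one_iff h01).1 hx with rfl | rfl <;>
      rcases (sign_eq_one_iff h01).1 hy with rfl | rfl <;> simp_all [lower]
  · intro x hx
    rcases (sign_eq_one_iff h01).1 hx with rfl | rfl
    · simp [lower, weight]
    · simp [lower, weight, sub_sub_eq_add_sub]
  · intro T hT p hp
    exact IsKNSkewTableau.update_lower hT h₀ h₁ hp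

end SP

/-! ### The hyperoctahedral group -/

theorem signedShift_iterate (χ : Fin m → ℤ) {k : ℕ} (hk : k ≤ m) (i : Fin m) :
    signedShift^[k] χ i = if h : k ≤ i.val then χ ⟨i.val - k, by omega⟩
      else -χ ⟨m + i.val - k, by omega⟩ := by
  induction k generalizing i with
  | zero => simp
  | succ k ih =>
    rw [Function.iterate_succ_apply', signedShift]
    by_cases hi : i.val = 0
    · rw [if_pos hi, ih (by omega), dif_pos (by simp only; omega), dif_neg (by omega)]
      congr 3
      simp only
      omega
    · rw [if_neg hi, ih (by omega)]
      by_cases h : k + 1 ≤ i.val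
      · rw [dif_pos (by simp only; omega), dif_pos h]
        congr 2
        simp only
        omega
      · rw [dif_neg (by simp only; omega), dif_neg h]
        congr 3
        simp only
        omega

theorem signedShift_iterate_self (χ : Fin m → ℤ) : signedShift^[m] χ = -χ := by
  funext i
  rw [signedShift_iterate χ le_rfl, dif_neg (by omega), Pi.neg_apply]
  congr 3
  omega

/-- Change the signs of the coordinates in `s`. -/
def flipSigns (s : Finset (Fin m)) (χ : Fin m → ℤ) : Fin m → ℤ :=
  fun i => if i ∈ s then -χ i else χ i

variable {M : Multiset (Fin m → ℤ)}

theorem map_iterate_eq (hM : M.map signedShift = M) (k : ℕ) :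
    M.map (signedShift^[k]) = M := by
  induction k with
  | zero => simp
  | succ k ih => rw [Function.iterate_succ', ← Multiset.map_map, ih, hM]

/-- A multiset of weights which is stable under the signed shift, and which contains `χ` at most as
often as its image under the transposition `(1 2)` if `χ₂ ≤ χ₁`, is stable under all
permutations. -/
theorem map_comp_perm_eq (hM : M.map signedShift = M)
    (hswap : ∀ i₀ i₁ : Fin m, i₀.val = 0 → i₁.val = 1 → ∀ χ : Fin m → ℤ, χ i₁ ≤ χ i₀ →
      M.count χ ≤ M.count (χ ∘ Equiv.swap i₀ i₁)) (σ : Equiv.Perm (Fin m)) :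
    M.map (fun χ => χ ∘ σ) = M := by
  classical
  have hneg : ∀ χ, M.count (-χ) = M.count χ := by
    intro χ
    have h := map_iterate_eq hM m
    have h' : (signedShift^[m] : (Fin m → ℤ) → _) = fun χ => -χ :=
      funext signedShift_iterate_self
    rw [h'] at h
    conv_lhs => rw [← h]
    exact Multiset.count_map_eq_count' _ _ neg_injective χ
  rcases m with _ | m
  · have : (fun χ : Fin 0 → ℤ => χ ∘ σ) = id := funext fun χ => Subsingleton.elim _ _
    rw [this, Multiset.map_id]
  have hfirst : ∀ i₀ i₁ : Fin (m + 1), i₀.val = 0 → i₁.val = 1 →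
      M.map (fun χ => χ ∘ Equiv.swap i₀ i₁) = M := by
    intro i₀ i₁ h₀ h₁
    have hinv : ∀ χ : Fin (m + 1) → ℤ, (χ ∘ Equiv.swap i₀ i₁) ∘ Equiv.swap i₀ i₁ = χ := by
      intro χ
      funext i
      simp
    have hinj : Function.Injective fun χ : Fin (m + 1) → ℤ => χ ∘ Equiv.swap i₀ i₁ := by
      intro χ χ' h
      have := congrArg (· ∘ Equiv.swap i₀ i₁) h
      simpa only [hinv] using this
    -- the opposite inequality comes from the symmetry under negation
    have hle : ∀ χ : Fin (m + 1) → ℤ, M.count χ ≤ M.count (χ ∘ Equiv.swap i₀ i₁) := by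
      intro χ
      rcases le_total (χ i₁) (χ i₀) with h | h
      · exact hswap i₀ i₁ h₀ h₁ χ h
      · rw [← hneg χ, ← hneg (χ ∘ _)]
        exact hswap i₀ i₁ h₀ h₁ (-χ) (by simpa using h)
    ext χ
    conv_lhs => rw [← hinv χ]
    rw [Multiset.count_map_eq_count' _ _ hinj]
    refine le_antisymm ?_ (hle χ)
    have := hle (χ ∘ Equiv.swap i₀ i₁)
    rwa [hinv] at this
  have hadj : ∀ k : ℕ, ∀ i j : Fin (m + 1), i.val = k → j.val = k + 1 →
      M.map (fun χ => χ ∘ Equiv.swap i j) = M := by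
    intro k
    induction k with
    | zero => exact hfirst
    | succ k ih =>
      intro i j hi hj
      have hconj : ∀ χ : Fin (m + 1) → ℤ, signedShift χ ∘ Equiv.swap i j =
          signedShift (χ ∘ Equiv.swap (⟨k, by omega⟩ : Fin (m + 1)) ⟨k + 1, by omega⟩) := by
        intro χ
        funext s
        simp only [Function.comp_apply, signedShift]
        by_cases h1 : s = i
        · subst h1
          rw [Equiv.swap_apply_left, if_neg (by omega), if_neg (by omega)]
          have : (⟨s.val - 1, by omega⟩ : Fin (m + 1)) = ⟨k, by omega⟩ := Fin.ext (by simp [hi])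
          rw [this, Equiv.swap_apply_left]
          congr 1
          exact Fin.ext (by simp [hj])
        by_cases h2 : s = j
        · subst h2
          rw [Equiv.swap_apply_right, if_neg (by omega), if_neg (by omega)]
          have : (⟨s.val - 1, by omega⟩ : Fin (m + 1)) = ⟨k + 1, by omega⟩ :=
            Fin.ext (by simp [hj])
          rw [this, Equiv.swap_apply_right]
          congr 1
          exact Fin.ext (by simp [hi])
        rw [Equiv.swap_apply_of_ne_of_ne h1 h2]
        rw [Fin.ext_iff] at h1 h2
        by_cases h3 : s.val = 0
        · rw [if_pos h3, if_pos h3, Equiv.swap_apply_of_ne_of_ne] <;>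
            rw [Ne, Fin.ext_iff] <;> simp only <;> omega
        · rw [if_neg h3, if_neg h3, Equiv.swap_apply_of_ne_of_ne] <;>
            rw [Ne, Fin.ext_iff] <;> simp only <;> omega
      conv_lhs => rw [← hM]
      rw [Multiset.map_map]
      simp only [Function.comp_def] at hconj ⊢
      simp only [hconj]
      have h := congrArg (Multiset.map signedShift)
        (ih ⟨k, by omega⟩ ⟨k + 1, by omega⟩ rfl rfl)
      rw [Multiset.map_map, hM] at h
      exact h
  have hmem : σ ∈ Submonoid.closure (Set.range fun i : Fin m =>
      Equiv.swap i.castSucc i.succ) := by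
    rw [Equiv.Perm.mclosure_swap_castSucc_succ]
    exact Submonoid.mem_top σ
  induction hmem using Submonoid.closure_induction with
  | mem x hx =>
    obtain ⟨i, rfl⟩ := hx
    exact hadj i.val _ _ rfl rfl
  | one => simp
  | mul x y _ _ hx hy =>
    have : (fun χ : Fin (m + 1) → ℤ => χ ∘ (x * y : Equiv.Perm (Fin (m + 1)))) =
        (fun χ => χ ∘ y) ∘ fun χ => χ ∘ x := rfl
    rw [this, ← Multiset.map_map, hx, hy]

theorem map_flipSigns_eq (hM : M.map signedShift = M)
    (hperm : ∀ σ : Equiv.Perm (Fin m), M.map (fun χ => χ ∘ σ) = M) (s : Finset (Fin m)) :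
    M.map (flipSigns s) = M := by
  classical
  induction s using Finset.induction_on with
  | empty =>
    have : flipSigns (∅ : Finset (Fin m)) = id := by
      funext χ i
      simp [flipSigns]
    rw [this, Multiset.map_id]
  | insert a s ha ih =>
    have hm : 0 < m := a.pos
    -- the signed shift, followed by an unsigned shift backwards, changes a single sign
    have hfirst : M.map (flipSigns {(⟨0, hm⟩ : Fin m)}) = M := by
      obtain ⟨m, rfl⟩ : ∃ m', m = m' + 1 := ⟨m - 1, by omega⟩
      have h : flipSigns {(⟨0, hm⟩ : Fin (m + 1))} =
          signedShift ∘ fun χ => χ ∘ finRotate (m + 1) := by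
        funext χ i
        simp only [flipSigns, Function.comp_apply, signedShift, Finset.mem_singleton, Fin.ext_iff]
        split_ifs with hi
        · have h1 : (⟨m + 1 - 1, by omega⟩ : Fin (m + 1)) = Fin.last m := rfl
          have h2 : i = 0 := Fin.ext hi
          rw [h1, finRotate_last, h2]
        · rw [finRotate_of_lt (by omega)]
          congr 1
          exact Fin.ext (by simp only; omega)
      rw [h, ← Multiset.map_map, hperm, hM]
    have hsingle : M.map (flipSigns {a}) = M := by
      have h : flipSigns {a} = (fun χ => χ ∘ Equiv.swap ⟨0, hm⟩ a) ∘
          flipSigns {(⟨0, hm⟩ : Fin m)} ∘ fun χ => χ ∘ Equiv.swap ⟨0, hm⟩ a := by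
        funext χ i
        simp only [flipSigns, Function.comp_apply, Finset.mem_singleton, Equiv.swap_apply_self,
          Equiv.swap_apply_eq_iff, Equiv.swap_apply_left]
      rw [h, ← Multiset.map_map, ← Multiset.map_map, hperm, hfirst, hperm]
    have h : flipSigns (insert a s) = flipSigns {a} ∘ flipSigns s := by
      funext χ i
      by_cases hi : i = a
      · subst hi
        simp [flipSigns, ha]
      · simp [flipSigns, hi]
    rw [h, ← Multiset.map_map, ih, hsingle]

end Weights

/-! ### Orbit sums -/

section OrbitSums

variable {m : ℕ} {K : Type*} [Field K]

/-- The sum of the monomials `∏ j, x_{u j} ^ (± A j)` over all choices of distinct indices `u j` and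
of signs. For `ℓ = m` it is, up to a factor, the sum of the monomials in the orbit of `A` under
the hyperoctahedral group. -/
noncomputable def orbitSum (x : Fin m → K) {ℓ : ℕ} (A : Fin ℓ → ℤ) : K :=
  ∑ u : Fin ℓ ↪ Fin m, ∏ j, (x (u j) ^ A j + x (u j) ^ (-A j))

theorem sum_update_int {ℓ : ℕ} (f : Fin ℓ → ℤ) (k : Fin ℓ) (v : ℤ) :
    ∑ j, Function.update f k v j = ∑ j, f j - f k + v := by
  rw [Finset.sum_update_of_mem (Finset.mem_univ k), ← Finset.erase_eq,
    ← Finset.add_sum_erase _ f (Finset.mem_univ k)]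
  ring

theorem mul_prod_zpow_add (x : Fin m → K) (hx : ∀ i, x i ≠ 0) {ℓ : ℕ} (A : Fin ℓ → ℤ)
    (u : Fin ℓ → Fin m) (a : ℤ) (k : Fin ℓ) :
    (x (u k) ^ a + x (u k) ^ (-a)) * ∏ j, (x (u j) ^ A j + x (u j) ^ (-A j)) =
      (∏ j, (x (u j) ^ Function.update A k (A k + a) j +
        x (u j) ^ (-Function.update A k (A k + a) j))) +
      ∏ j, (x (u j) ^ Function.update A k (A k - a) j +
        x (u j) ^ (-Function.update A k (A k - a) j)) := by
  have h : ∀ v : ℤ, ∏ j, (x (u j) ^ Function.update A k v j +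
      x (u j) ^ (-Function.update A k v j)) = (x (u k) ^ v + x (u k) ^ (-v)) *
        ∏ j ∈ Finset.univ.erase k, (x (u j) ^ A j + x (u j) ^ (-A j)) := by
    intro v
    rw [← Finset.mul_prod_erase _ _ (Finset.mem_univ k), Function.update_self]
    congr 1
    refine Finset.prod_congr rfl fun j hj => ?_
    rw [Function.update_of_ne (Finset.ne_of_mem_erase hj)]
  rw [h, h, ← Finset.mul_prod_erase _ _ (Finset.mem_univ k), ← mul_assoc, ← add_mul]
  congr 1
  have hk := hx (u k)
  simp only [neg_add, sub_eq_add_neg, zpow_add₀ hk, zpow_neg, inv_inv]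
  ring

/-- Expansion of the product of an orbit sum and a power sum. -/
theorem orbitSum_succ (x : Fin m → K) (hx : ∀ i, x i ≠ 0) {ℓ : ℕ} (A : Fin (ℓ + 1) → ℤ) :
    orbitSum x A = (∑ i, (x i ^ A 0 + x i ^ (-A 0))) * orbitSum x (Fin.tail A) -
      ∑ k, (orbitSum x (Function.update (Fin.tail A) k (Fin.tail A k + A 0)) +
        orbitSum x (Function.update (Fin.tail A) k (Fin.tail A k - A 0))) := by
  classical
  have h1 : ∀ u : Fin ℓ ↪ Fin m, ∑ i : {i // i ∉ Set.range u}, (x i ^ A 0 + x i ^ (-A 0)) =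
      ∑ i, (x i ^ A 0 + x i ^ (-A 0)) - ∑ k, (x (u k) ^ A 0 + x (u k) ^ (-A 0)) := by
    intro u
    rw [eq_sub_iff_add_eq]
    have h2 : ∑ k, (x (u k) ^ A 0 + x (u k) ^ (-A 0)) =
        ∑ i : {i // i ∈ Set.range u}, (x i ^ A 0 + x i ^ (-A 0)) :=
      Fintype.sum_equiv (Equiv.ofInjective u u.injective) _ _ fun k => rfl
    rw [h2, add_comm]
    convert Fintype.sum_subtype_add_sum_subtype (fun i => i ∈ Set.range u)
      fun i => x i ^ A 0 + x i ^ (-A 0)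
  calc orbitSum x A = ∑ f : Σ u : Fin ℓ ↪ Fin m, {i // i ∉ Set.range u},
        (x f.2 ^ A 0 + x f.2 ^ (-A 0)) *
          ∏ j, (x (f.1 j) ^ Fin.tail A j + x (f.1 j) ^ (-Fin.tail A j)) := by
        refine Fintype.sum_equiv (Equiv.embeddingFinSucc ℓ (Fin m)) _ _ fun u => ?_
        rw [Fin.prod_univ_succ]
        rfl
    _ = ∑ u : Fin ℓ ↪ Fin m, (∑ i, (x i ^ A 0 + x i ^ (-A 0)) -
          ∑ k, (x (u k) ^ A 0 + x (u k) ^ (-A 0))) *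
          ∏ j, (x (u j) ^ Fin.tail A j + x (u j) ^ (-Fin.tail A j)) := by
        rw [Fintype.sum_sigma]
        refine Finset.sum_congr rfl fun u _ => ?_
        rw [← h1, Finset.sum_mul]
    _ = _ := by
        simp only [sub_mul, Finset.sum_sub_distrib, Finset.sum_mul, mul_prod_zpow_add x hx,
          orbitSum, Finset.mul_sum]
        congr 1
        rw [Finset.sum_comm]
        simp only [Finset.sum_add_distrib]

/-- If the power sums of odd degree up to `n` vanish, then so do the orbit sums of odd degree up
to `n`. -/
theorem orbitSum_eq_zero (x : Fin m → K) (hx : ∀ i, x i ≠ 0) (n : ℤ)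
    (hp : ∀ a : ℤ, Odd a → |a| ≤ n → ∑ i, (x i ^ a + x i ^ (-a)) = 0) {ℓ : ℕ} (A : Fin ℓ → ℤ)
    (hodd : Odd (∑ j, A j)) (hle : ∑ j, |A j| ≤ n) : orbitSum x A = 0 := by
  induction ℓ with
  | zero => simp at hodd
  | succ ℓ ih =>
    rw [Fin.sum_univ_succ] at hodd hle
    have hodd' : Odd (A 0 + ∑ j, Fin.tail A j) := hodd
    have hle' : |A 0| + ∑ j, |Fin.tail A j| ≤ n := hle
    have habs : ∀ k v, ∑ j, |Function.update (Fin.tail A) k v j| =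
        ∑ j, |Fin.tail A j| - |Fin.tail A k| + |v| := by
      intro k v
      rw [← sum_update_int]
      refine Finset.sum_congr rfl fun j _ => ?_
      exact Function.apply_update (fun _ (y : ℤ) => |y|) _ _ _ _
    have h0 : 0 ≤ ∑ j, |Fin.tail A j| := Finset.sum_nonneg fun _ _ => abs_nonneg _
    have hmerge : ∀ k, orbitSum x (Function.update (Fin.tail A) k (Fin.tail A k + A 0)) +
        orbitSum x (Function.update (Fin.tail A) k (Fin.tail A k - A 0)) = 0 := by
      intro k
      rw [ih, ih, add_zero]
      · rw [sum_update_int]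
        have : ∑ j, Fin.tail A j - Fin.tail A k + (Fin.tail A k - A 0) =
            A 0 + ∑ j, Fin.tail A j - 2 * A 0 := by ring
        rw [this]
        exact hodd'.sub_even (even_two_mul _)
      · rw [habs]
        have := abs_sub (Fin.tail A k) (A 0)
        linarith
      · rw [sum_update_int]
        have : ∑ j, Fin.tail A j - Fin.tail A k + (Fin.tail A k + A 0) =
            A 0 + ∑ j, Fin.tail A j := by ring
        rwa [this]
      · rw [habs]
        have := abs_add_le (Fin.tail A k) (A 0)
        linarith
    rw [orbitSum_succ x hx, Finset.sum_eq_zero fun k _ => hmerge k, sub_zero]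
    rcases Int.even_or_odd (A 0) with he | ho
    · rw [ih (Fin.tail A) ((Int.odd_add'.1 hodd').2 he)
        (by have := abs_nonneg (A 0); linarith), mul_zero]
    · rw [hp _ ho (by linarith), zero_mul]

theorem orbitSum_eq_sum_perm (x : Fin m → K) (χ : Fin m → ℤ) :
    orbitSum x χ = ∑ σ : Equiv.Perm (Fin m), ∑ s : Finset (Fin m),
      ∏ i, x i ^ flipSigns s (χ ∘ σ) i := by
  classical
  let e : Equiv.Perm (Fin m) ≃ (Fin m ↪ Fin m) :=
    (Equiv.inv _).trans
      { toFun := fun σ => σ.toEmbedding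
        invFun := fun u => u.equivOfFiniteSelfEmbedding
        left_inv := fun σ => by ext; rfl
        right_inv := fun u => by simp }
  refine (Fintype.sum_equiv e _ _ fun σ => ?_).symm
  have h1 : ∏ j, (x (e σ j) ^ χ j + x (e σ j) ^ (-χ j)) =
      ∏ i, (x i ^ (-(χ ∘ σ) i) + x i ^ (χ ∘ σ) i) := by
    refine (Fintype.prod_equiv σ _ _ fun i => ?_).symm
    have : e σ (σ i) = i := σ.symm_apply_apply i
    rw [this, add_comm]
    rfl
  rw [h1, Fintype.prod_add]
  refine Finset.sum_congr rfl fun s _ => ?_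
  rw [← Finset.prod_mul_prod_compl s]
  congr 1
  · refine Finset.prod_congr rfl fun i hi => ?_
    rw [flipSigns, if_pos hi]
  · refine Finset.prod_congr rfl fun i hi => ?_
    rw [flipSigns, if_neg (Finset.mem_compl.1 hi)]

/-- The monomials of a multiset of weights of odd degree up to `n`, stable under the hyperoctahedral
group, sum to zero if the power sums of odd degree up to `n` vanish. -/
theorem sum_monomials_eq_zero [CharZero K] {M : Multiset (Fin m → ℤ)} (x : Fin m → K)
    (hx : ∀ i, x i ≠ 0) (n : ℤ)
    (hp : ∀ a : ℤ, Odd a → |a| ≤ n → ∑ i, (x i ^ a + x i ^ (-a)) = 0)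
    (hperm : ∀ σ : Equiv.Perm (Fin m), M.map (fun χ => χ ∘ σ) = M)
    (hflip : ∀ s : Finset (Fin m), M.map (flipSigns s) = M)
    (hodd : ∀ χ ∈ M, Odd (∑ i, χ i)) (hle : ∀ χ ∈ M, ∑ i, |χ i| ≤ n) :
    (M.map fun χ => ∏ i, x i ^ χ i).sum = 0 := by
  classical
  have h1 : (M.map fun χ => orbitSum x χ).sum = 0 := by
    refine Multiset.sum_eq_zero fun y hy => ?_
    obtain ⟨χ, hχ, rfl⟩ := Multiset.mem_map.1 hy
    exact orbitSum_eq_zero x hx n hp χ (hodd χ hχ) (hle χ hχ)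
  have h2 : ∀ (σ : Equiv.Perm (Fin m)) (s : Finset (Fin m)),
      (M.map fun χ => ∏ i, x i ^ flipSigns s (χ ∘ σ) i).sum =
        (M.map fun χ => ∏ i, x i ^ χ i).sum := by
    intro σ s
    conv_rhs => rw [← hflip s, ← hperm σ, Multiset.map_map, Multiset.map_map]
    rfl
  simp only [orbitSum_eq_sum_perm] at h1
  have h3 : (M.map fun χ => ∑ σ : Equiv.Perm (Fin m), ∑ s : Finset (Fin m),
      ∏ i, x i ^ flipSigns s (χ ∘ σ) i).sum = ∑ σ : Equiv.Perm (Fin m), ∑ s : Finset (Fin m),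
        (M.map fun χ => ∏ i, x i ^ flipSigns s (χ ∘ σ) i).sum := by
    refine (Multiset.sum_map_sum_map M _).trans (Finset.sum_congr rfl fun σ _ => ?_)
    exact Multiset.sum_map_sum_map M _
  rw [h3] at h1
  simp only [h2, Finset.sum_const, nsmul_eq_mul, ← mul_assoc] at h1
  refine (mul_eq_zero.1 h1).resolve_left (mul_ne_zero ?_ ?_) <;>
    exact Nat.cast_ne_zero.2 (Finset.card_ne_zero.2 Finset.univ_nonempty)

/-- The power sums of the odd powers of `η`, telescoped. -/
theorem sum_odd_powers_eq_zero {η : K} (hη : η ^ (4 * m) = 1) {a : ℤ}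
    (ha : (η ^ 2) ^ a ≠ 1) (hη0 : η ≠ 0) :
    ∑ i : Fin m, ((η ^ (2 * i.val + 1)) ^ a + (η ^ (2 * i.val + 1)) ^ (-a)) = 0 := by
  set y := η ^ a with hy
  have hy0 : y ≠ 0 := zpow_ne_zero _ hη0
  have hy2 : y ^ 2 ≠ 1 := by
    rwa [hy, ← zpow_natCast, ← zpow_mul, mul_comm, zpow_mul, zpow_natCast]
  have hy4 : y ^ (4 * m) = 1 := by
    rw [hy, ← zpow_natCast, ← zpow_mul, mul_comm, zpow_mul, zpow_natCast, hη, one_zpow]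
  have hterm : ∀ k : ℕ, (η ^ k) ^ a = y ^ k := fun k => by
    rw [hy, ← zpow_natCast, ← zpow_natCast, ← zpow_mul, ← zpow_mul, mul_comm]
  have htel : ∀ N : ℕ, (y - y⁻¹) * ∑ i ∈ Finset.range N, (y ^ (2 * i + 1) + (y ^ (2 * i + 1))⁻¹) =
      y ^ (2 * N) - (y ^ (2 * N))⁻¹ := by
    intro N
    induction N with
    | zero => simp
    | succ N ih =>
      rw [Finset.sum_range_succ, mul_add, ih]
      field_simp
      ring
  have h := htel m
  have h2 : y ^ (2 * m) - (y ^ (2 * m))⁻¹ = 0 := by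
    rw [sub_eq_zero]
    refine eq_inv_of_mul_eq_one_left ?_
    rw [← pow_add, ← hy4]
    congr 1
    ring
  rw [h2] at h
  simp only [zpow_neg, hterm]
  rw [Fin.sum_univ_eq_sum_range fun i => y ^ (2 * i + 1) + (y ^ (2 * i + 1))⁻¹]
  refine (mul_eq_zero.1 h).resolve_left fun h' => hy2 ?_
  rw [sub_eq_zero] at h'
  rw [sq]
  nth_rewrite 2 [h']
  exact mul_inv_cancel₀ hy0

end OrbitSums

/-! ### Fixed points and the evaluation at roots of unity -/

section Sieving

open KNLetter

variable {m : ℕ} {lam mu : YoungDiagram}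

namespace SP

theorem sum_count (hmu : mu ≤ lam) (T : SP lam mu m) :
    ∑ i, (T.count (pos i) + T.count (bar i)) = lam.card - mu.card := by
  have h1 : Fintype.card (SkewCell lam mu) = lam.card - mu.card := by
    rw [Fintype.card_coe, Finset.card_sdiff_of_subset hmu]
  have h2 : ((∑ i, (T.count (pos i) + T.count (bar i)) : ℕ) : ℤ) =
      (Fintype.card (SkewCell lam mu) : ℕ) := by
    push_cast
    simp only [count_eq_sum, ← Finset.sum_add_distrib]
    have h3 : ∀ x : KNLetter m,
        ∑ i, ((if x = pos i then (1 : ℤ) else 0) + if x = bar i then 1 else 0) = 1 := by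
      rintro (s | s) <;> simp
    rw [Finset.sum_comm]
    simp [h3]
  rw [← h1]
  exact_mod_cast h2

theorem odd_sum_wt (hmu : mu ≤ lam) (hodd : Odd (lam.card - mu.card)) (T : SP lam mu m) :
    Odd (∑ i, T.wt i) := by
  have h : ∑ i, T.wt i = ((lam.card - mu.card : ℕ) : ℤ) - 2 * ∑ i, (T.count (bar i) : ℤ) := by
    rw [← sum_count hmu T, Finset.mul_sum]
    push_cast
    rw [← Finset.sum_sub_distrib]
    exact Finset.sum_congr rfl fun i _ => by rw [wt]; ring
  rw [h]
  exact Odd.sub_even (by exact_mod_cast hodd) (even_two_mul _)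

theorem sum_abs_wt_le (hmu : mu ≤ lam) (T : SP lam mu m) :
    ∑ i, |T.wt i| ≤ ((lam.card - mu.card : ℕ) : ℤ) := by
  rw [← sum_count hmu T]
  push_cast
  refine Finset.sum_le_sum fun i _ => ?_
  rw [wt, abs_le]
  constructor <;> linarith [Int.natCast_nonneg (T.count (pos i)),
    Int.natCast_nonneg (T.count (bar i))]

/-- Up to the factor `η ^ n`, the monomial of `pwr T` at `η ^ 2` is the monomial of `wt T` at the
point with coordinates `η ^ (2 i - 1)`. -/
theorem prod_zpow_wt {K : Type*} [Field K] {η : K} (hη : η ^ (4 * m) = 1) (hη0 : η ≠ 0)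
    (hmu : mu ≤ lam) (T : SP lam mu m) :
    ∏ i : Fin m, (η ^ (2 * i.val + 1)) ^ T.wt i =
      η ^ (lam.card - mu.card) * (η ^ 2) ^ T.pwr := by
  rw [← sum_count hmu T, ← pow_mul, ← pow_add, pwr, Finset.mul_sum, ← Finset.sum_add_distrib,
    ← Finset.prod_pow_eq_pow_sum]
  refine Finset.prod_congr rfl fun i _ => ?_
  have hi := i.isLt
  rw [wt, zpow_sub₀ (pow_ne_zero _ hη0), zpow_natCast, zpow_natCast,
    div_eq_iff (pow_ne_zero _ (pow_ne_zero _ hη0)), ← pow_mul, ← pow_mul, ← pow_add]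
  obtain ⟨k, hk⟩ : ∃ k, m = i.val + 1 + k := ⟨m - (i.val + 1), by omega⟩
  have h1 : 2 * m - (i.val + 1) = i.val + 1 + 2 * k := by omega
  have h2 : T.count (pos i) + T.count (bar i) + 2 * (i.val * T.count (pos i) +
      (2 * m - (i.val + 1)) * T.count (bar i)) + (2 * i.val + 1) * T.count (bar i) =
      (2 * i.val + 1) * T.count (pos i) + 4 * m * T.count (bar i) := by
    have h3 : 4 * m = 4 * (i.val + 1 + k) := by omega
    rw [h1, h3]
    ring
  rw [h2, pow_add, pow_mul η (4 * m), hη, one_pow, mul_one]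

end SP

/-- In the presence of the arithmetic condition, an odd exponent of absolute value at most `n`
does not annihilate a nontrivial `2m`-th root of unity. -/
theorem zpow_ne_one_of_odd {K : Type*} [Field K] {n : ℕ}
    (hgcd : ∀ p : ℕ, p.Prime → Odd p → p ≤ n → Nat.gcd m p = 1) {ζ : K}
    (hζ : ζ ^ (2 * m) = 1) (hζ1 : ζ ≠ 1) {a : ℤ} (ha : Odd a) (han : |a| ≤ n) : ζ ^ a ≠ 1 := by
  intro h
  have hdvd : orderOf ζ ∣ a.natAbs := by
    refine orderOf_dvd_of_pow_eq_one ?_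
    rcases Int.natAbs_eq a with h' | h' <;> rw [h'] at h
    · rwa [zpow_natCast] at h
    · rwa [zpow_neg, zpow_natCast, inv_eq_one] at h
  have hkodd : Odd (orderOf ζ) := Odd.of_dvd_nat (Int.natAbs_odd.2 ha) hdvd
  have hkm : orderOf ζ ∣ m :=
    (Nat.Coprime.dvd_mul_left hkodd.coprime_two_right).1 (orderOf_dvd_of_pow_eq_one hζ)
  have hk1 : orderOf ζ ≠ 1 := fun h => hζ1 (orderOf_eq_one_iff.1 h)
  have hq := Nat.minFac_prime hk1
  have hqk := Nat.minFac_dvd (orderOf ζ)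
  have hqn : (orderOf ζ).minFac ≤ n := by
    have h1 : a.natAbs ≠ 0 := by
      rintro h0
      rw [Int.natAbs_eq_zero] at h0
      simp [h0] at ha
    have h2 := Nat.le_of_dvd (Nat.pos_of_ne_zero h1) (hqk.trans hdvd)
    rw [Int.abs_eq_natAbs] at han
    omega
  have := hgcd _ hq (hkodd.of_dvd_nat hqk) hqn
  rw [Nat.gcd_eq_right (hqk.trans hkm)] at this
  exact hq.one_lt.ne' this

theorem sum_range_mul_of_periodic (f : ℕ → ℤ) {e : ℕ} (hf : ∀ k, f (k + e) = f k) (q : ℕ) :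
    ∑ k ∈ Finset.range (q * e), f k = q * ∑ k ∈ Finset.range e, f k := by
  have hf' : ∀ q k, f (q * e + k) = f k := by
    intro q
    induction q with
    | zero => simp
    | succ q ih =>
      intro k
      rw [show (q + 1) * e + k = q * e + k + e by ring, hf, ih]
  induction q with
  | zero => simp
  | succ q ih =>
    rw [Nat.succ_mul, Finset.sum_range_add, ih]
    simp only [hf']
    push_cast
    ring

/-- A weight which is fixed by a power of the signed shift of odd order `q` has absolute sum
divisible by `q`: the absolute values of its coordinates are repeated `q` times. -/
theorem dvd_sum_abs_of_iterate_eq {χ : Fin m → ℤ} {q e : ℕ} (hq : Odd q) (hqe : q * e = 2 * m)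
    (hχ : signedShift^[e] χ = χ) : (q : ℤ) ∣ ∑ i, |χ i| := by
  rcases Nat.eq_zero_or_pos m with rfl | hm
  · simp
  let l : Fin m := ⟨m - 1, by omega⟩
  let f : ℕ → ℤ := fun k => |signedShift^[k] χ l|
  have hfe : ∀ k, f (k + e) = f k := fun k => by
    simp only [f]
    rw [Function.iterate_add_apply, hχ]
  have hfm : ∀ k, f (k + m) = f k := fun k => by
    simp only [f]
    rw [add_comm, Function.iterate_add_apply, signedShift_iterate_self, Pi.neg_apply, abs_neg]
  have hsum : ∑ k ∈ Finset.range m, f k = ∑ i, |χ i| := by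
    rw [← Fin.sum_univ_eq_sum_range, ← Equiv.sum_comp Fin.revPerm]
    refine Finset.sum_congr rfl fun i _ => ?_
    simp only [f]
    rw [signedShift_iterate χ (by simp only [Fin.revPerm_apply, Fin.val_rev]; omega),
      dif_pos (by simp only [Fin.revPerm_apply, Fin.val_rev, l]; omega)]
    congr 2
    exact Fin.ext (by simp only [Fin.revPerm_apply, Fin.val_rev, l]; omega)
  have h1 := sum_range_mul_of_periodic f hfe q
  have h2 := sum_range_mul_of_periodic f hfm 2
  rw [hqe, h2, hsum] at h1
  refine IsCoprime.dvd_of_dvd_mul_left (y := 2) ?_ ⟨_, by exact_mod_cast h1⟩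
  exact_mod_cast Nat.isCoprime_iff_coprime.2 hq.coprime_two_right

/-- A weight of odd sum is not fixed by a power of the signed shift of prime order. -/
theorem iterate_signedShift_ne {n : ℕ}
    (hgcd : ∀ p : ℕ, p.Prime → Odd p → p ≤ n → Nat.gcd m p = 1) {χ : Fin m → ℤ}
    (hodd : Odd (∑ i, χ i)) (hle : ∑ i, |χ i| ≤ n) {q e : ℕ} (hq : q.Prime)
    (hqe : q * e = 2 * m) : signedShift^[e] χ ≠ χ := by
  intro hχ
  rcases hq.eq_two_or_odd' with rfl | hqo
  · have he : e = m := by omega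
    rw [he, signedShift_iterate_self] at hχ
    have h0 : ∀ i, χ i = 0 := fun i => by
      have := congrFun hχ i
      rw [Pi.neg_apply] at this
      omega
    simp [h0] at hodd
  · have hdvd := dvd_sum_abs_of_iterate_eq hqo hqe hχ
    have hqm : q ∣ m :=
      (Nat.Coprime.dvd_mul_left hqo.coprime_two_right).1 ⟨e, hqe.symm⟩
    have hpos : 0 < ∑ i, |χ i| := by
      have h1 := Finset.abs_sum_le_sum_abs χ Finset.univ
      have h2 : ∑ i, χ i ≠ 0 := fun h => by simp [h] at hodd
      exact (abs_pos.2 h2).trans_le h1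
    have hqn : q ≤ n := by
      have := (Int.le_of_dvd hpos hdvd).trans hle
      exact_mod_cast this
    have := hgcd q hq hqo hqn
    rw [Nat.gcd_eq_right hqm] at this
    exact hq.one_lt.ne' this

end Sieving

theorem theorem5p5 (m n : ℕ) (hm : 1 ≤ m) (lam mu : YoungDiagram) (hmu : mu ≤ lam)
    (hn : lam.card - mu.card = n) (hodd : Odd n)
    (hgcd : ∀ p : ℕ, p.Prime → Odd p → p ≤ n → Nat.gcd m p = 1)
    {G : Type*} [Group G] [MulAction G (SP lam mu m)] (g : G)
    (hgen : Subgroup.zpowers g = ⊤) (hcard : Nat.card G = 2 * m)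
    (hwt : ∀ T : SP lam mu m, (g • T).wt = signedShift T.wt) :
    ExhibitsCSP (SP lam mu m) g (SP.genPoly lam mu m) := by
  intro ω hω d
  rw [hcard] at hω
  have hog : orderOf g = 2 * m := by
    rw [← hcard, ← Nat.card_zpowers, hgen, Subgroup.card_top]
  have hX : Polynomial.aeval (ω ^ d) (SP.genPoly lam mu m) =
      ∑ T : SP lam mu m, (ω ^ d) ^ T.pwr := by
    simp [SP.genPoly]
  rw [hX]
  have hζ : (ω ^ d) ^ (2 * m) = 1 := by
    rw [← pow_mul, mul_comm, pow_mul, hω.pow_eq_one, one_pow]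
  have hoddT : ∀ T : SP lam mu m, Odd (∑ i, T.wt i) := fun T =>
    T.odd_sum_wt hmu (by rwa [hn])
  have hleT : ∀ T : SP lam mu m, ∑ i, |T.wt i| ≤ n := fun T => hn ▸ T.sum_abs_wt_le hmu
  by_cases hd : ω ^ d = 1
  · have hgd : g ^ d = 1 := by
      rw [← orderOf_dvd_iff_pow_eq_one, hog]
      exact (hω.pow_eq_one_iff_dvd d).1 hd
    simp [hgd, hd, Nat.card_eq_fintype_card]
  · -- the left side counts nothing, and the right side has to be shown to vanish
    have hleft : IsEmpty {T : SP lam mu m // g ^ d • T = T} := by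
      refine ⟨fun ⟨T, hT⟩ => ?_⟩
      set r := Nat.gcd (2 * m) d with hr
      have hfix : g ^ r • T = T := by
        have h1 : g ^ (r : ℤ) ∈ MulAction.stabilizer G T := by
          rw [hr, Nat.gcd_eq_gcd_ab, zpow_add, zpow_mul, zpow_mul, zpow_natCast, zpow_natCast,
            ← hog, pow_orderOf_eq_one, one_zpow, one_mul]
          exact zpow_mem (MulAction.mem_stabilizer_iff.2 hT) _
        rwa [zpow_natCast, MulAction.mem_stabilizer_iff] at h1
      obtain ⟨k, hk⟩ := Nat.gcd_dvd_left (2 * m) d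
      rw [← hr] at hk
      have hk1 : k ≠ 1 := by
        rintro rfl
        rw [mul_one] at hk
        refine hd ((hω.pow_eq_one_iff_dvd d).2 ?_)
        rw [hk]
        exact Nat.gcd_dvd_right _ _
      obtain ⟨b, hb⟩ := Nat.minFac_dvd k
      have hfix' : g ^ (r * b) • T = T := by
        rw [pow_mul]
        exact pow_mem (MulAction.mem_stabilizer_iff.2 hfix : g ^ r ∈ MulAction.stabilizer G T) b
      have hiter : ∀ j, (g ^ j • T).wt = signedShift^[j] T.wt := by
        intro j
        induction j with
        | zero => simp
        | succ j ih => rw [pow_succ', mul_smul, hwt, ih, Function.iterate_succ_apply']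
      refine iterate_signedShift_ne hgcd (hoddT T) (hleT T) (Nat.minFac_prime hk1)
        (e := r * b) ?_ ?_
      · rw [hk]
        conv_rhs => rw [hb]
        ring
      · rw [← hiter, hfix']
    rw [Nat.card_of_isEmpty, Nat.cast_zero]
    obtain ⟨η, hη⟩ : ∃ η : ℂ, η ^ 2 = ω ^ d := IsAlgClosed.exists_pow_nat_eq _ two_pos
    have hη4 : η ^ (4 * m) = 1 := by
      rw [← hζ, ← hη, ← pow_mul]
      congr 1
      ring
    have hη0 : η ≠ 0 := by
      rintro rfl
      rw [zero_pow (by omega)] at hη4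
      exact zero_ne_one hη4
    have hM : (SP.weights lam mu m).map signedShift = SP.weights lam mu m := by
      have h1 : signedShift ∘ SP.wt = SP.wt ∘ fun T : SP lam mu m => g • T :=
        funext fun T => (hwt T).symm
      rw [SP.weights, Multiset.map_map, h1, ← Multiset.map_map]
      congr 1
      exact Multiset.map_univ_val_equiv (MulAction.toPerm g)
    have hperm := map_comp_perm_eq hM fun i₀ i₁ h₀ h₁ χ hχ => SP.count_weights_le_swap h₀ h₁ hχ
    have hzero := sum_monomials_eq_zero (M := SP.weights lam mu m)
      (fun i : Fin m => η ^ (2 * i.val + 1)) (fun i => pow_ne_zero _ hη0) n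
      (fun a ha han => sum_odd_powers_eq_zero hη4
        (by rw [hη]; exact zpow_ne_one_of_odd hgcd hζ hd ha han) hη0)
      hperm (map_flipSigns_eq hM hperm)
      (by simpa [SP.weights] using hoddT) (by simpa [SP.weights] using hleT)
    rw [SP.weights, Multiset.map_map] at hzero
    have hzero' : ∑ T : SP lam mu m, η ^ (lam.card - mu.card) * (η ^ 2) ^ T.pwr = 0 := by
      rw [← hzero]
      exact Finset.sum_congr rfl fun T _ => (T.prod_zpow_wt hη4 hη0 hmu).symm
    rw [← Finset.mul_sum, hη] at hzero'
    exact ((mul_eq_zero.1 hzero').resolve_left (pow_ne_zero _ hη0)).symm
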